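/- Let $R$ be a commutative Noetherian local ring with residue field $k$. A quasi-projective resolution of an $R$-module $M$ is a bounded below complex $P$ of projective $R$-modules for which there are non-negative integers $a_i$, not all zero, with $H_i(P)\cong M^{\oplus a_i}$ for all $i$; it is finite if $P$ is bounded. The quasi-projective dimension $\operatorname{qpd}_R M$ is $-\infty$ if $M=0$, and otherwise the infimum (possibly $\infty$) of $\sup\{i: P_i\neq 0\}-\sup\{i: H_i(P)\neq 0\}$ over all finite quasi-projective resolutions $P$ of $M$; it is called finite if $\operatorname{qpd}_R M<\infty$. An $n$th syzygy $\Omega^n M$ of a finitely generated module $M$ is obtained by setting $\Omega^0M=M$ and letting $\Omega^{j+1}M$ be the kernel of a surjection from a finitely generated projective module onto $\Omega^{j}M$ (for instance, minimal free covers at every step). A transpose $\operatorname{Tr}M$ of a finitely generated module $M$ is the cokernel of the dual $\operatorname{Hom}_R(P_0,R)\to\operatorname{Hom}_R(P_1,R)$ of $f$, for a presentation $P_1\xrightarrow{f}P_0\to M\to 0$ by finitely generated projective modules. (1) Let $t=\operatorname{depth} R$. If $\operatorname{Tr}\Omega^t k$ has finite quasi-projective dimension, for some choice of the syzygy $\Omega^t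 k$ and of its transpose, then $R$ is Gorenstein. (2) If every finitely generated $R$-module has finite quasi-projective dimension, then $R$ is an AB ring; that is, $R$ is Gorenstein, and for all finitely generated $R$-modules $M$ and $N$ such that $\operatorname{Ext}^i_R(M,N)=0$ for all $i\gg0$, one has $\operatorname{Ext}^i_R(M,N)=0$ for all $i>\dim R$. -/

import Mathlib

open CategoryTheory

universe u

namespace QuasiProj

/-- A quasi-projective resolution of `M`: a bounded below complex `P` (homologically graded by `ℤ`)
of projective modules such that every `H_i(P)` is isomorphic to `M^{a_i}` for natural numbers `a_i`
that are not all zero. Below `inf P` the homology vanishes, so the condition is void there if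
`M ≠ 0`; if `M = 0` it says that `P` is exact. -/
structure IsQuasiProjectiveResolution (R : Type u) [CommRing R] (M : Type u) [AddCommGroup M]
    [Module R M] (P : ChainComplex (ModuleCat.{u} R) ℤ) : Prop where
  boundedBelow : ∃ b : ℤ, ∀ i < b, Subsingleton (P.X i)
  projective : ∀ i : ℤ, Module.Projective R (P.X i)
  homology : ∃ a : ℤ → ℕ, (∃ i, a i ≠ 0) ∧
    ∀ i : ℤ, Nonempty (P.homology i ≅ ModuleCat.of R (Fin (a i) → M))

/-- A quasi-projective resolution of finite length. -/
structure IsFiniteQuasiProjectiveResolution (R : Type u) [CommRing R] (M : Type u) [AddCommGroup M]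
    [Module R M] (P : ChainComplex (ModuleCat.{u} R) ℤ) : Prop
    extends IsQuasiProjectiveResolution R M P where
  boundedAbove : ∃ b : ℤ, ∀ i > b, Subsingleton (P.X i)

open Classical in
/-- The quasi-projective dimension of `M`: `⊥` (that is, `-∞`) if `M = 0`, and otherwise the infimum
of `sup P - hsup P` over the finite quasi-projective resolutions `P` of `M`, where
`s = sup P` is the largest degree with `P_s ≠ 0` and `h = hsup P` is the largest degree with
`H_h(P) ≠ 0`. The infimum over the empty set is `⊤` (that is, `∞`). -/
noncomputable def qpd (R : Type u) [CommRing R] (M : Type u) [AddCommGroup M] [Module R M] :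
    WithBot ℕ∞ :=
  if Subsingleton M then ⊥ else
    ((sInf {d : ℕ∞ | ∃ P : ChainComplex (ModuleCat.{u} R) ℤ,
      IsFiniteQuasiProjectiveResolution R M P ∧ ∃ s h : ℤ, ∃ n : ℕ,
        IsGreatest {i : ℤ | Nontrivial (P.X i)} s ∧
        IsGreatest {i : ℤ | Nontrivial (P.homology i)} h ∧
        s - h = n ∧ d = n} : ℕ∞) : WithBot ℕ∞)

/-- `X` is an `n`-th syzygy of `M`, formed from finitely generated projective modules:
`Ω^0 M = M`, and `Ω^(n+1) M` is the kernel of a surjection from a finitely generated projective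
module onto an `n`-th syzygy of `M`. -/
def IsSyzygy (R : Type u) [CommRing R] (M : ModuleCat.{u} R) : ℕ → ModuleCat.{u} R → Prop
  | 0, X => Nonempty (X ≃ₗ[R] M)
  | n + 1, X => ∃ Y : ModuleCat.{u} R, IsSyzygy R M n Y ∧
      ∃ (F : ModuleCat.{u} R) (f : F →ₗ[R] Y), Module.Finite R F ∧ Module.Projective R F ∧
        Function.Surjective f ∧ Nonempty (X ≃ₗ[R] LinearMap.ker f)

/-- `T` is an Auslander transpose of `M`: for some presentation `P₁ → P₀ → M → 0` by finitely
generated projective modules, `T` is the cokernel of the dual map `P₀* → P₁*`. -/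
def IsTranspose (R : Type u) [CommRing R] (M T : Type u) [AddCommGroup M] [Module R M]
    [AddCommGroup T] [Module R T] : Prop :=
  ∃ (P₁ P₀ : ModuleCat.{u} R) (f : P₁ →ₗ[R] P₀) (g : P₀ →ₗ[R] M),
    Module.Finite R P₁ ∧ Module.Projective R P₁ ∧ Module.Finite R P₀ ∧ Module.Projective R P₀ ∧
    Function.Exact f g ∧ Function.Surjective g ∧
    Nonempty (T ≃ₗ[R] (Module.Dual R P₁ ⧸ LinearMap.range f.dualMap))

/-- The depth of a local ring: the supremum of the lengths of the regular sequences on `R` that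
consist of elements of the maximal ideal. -/
noncomputable def depth (R : Type u) [CommRing R] [IsLocalRing R] : ℕ∞ :=
  sSup {d : ℕ∞ | ∃ rs : List R, (∀ r ∈ rs, r ∈ IsLocalRing.maximalIdeal R) ∧
    RingTheory.Sequence.IsRegular R rs ∧ d = rs.length}

/-- A local ring is Gorenstein if it is Noetherian and has finite injective dimension as a module
over itself. -/
structure IsGorensteinLocalRing (R : Type u) [CommRing R] : Prop where
  isLocalRing : IsLocalRing R
  isNoetherianRing : IsNoetherianRing R
  injectiveDimension_lt_top : injectiveDimension (ModuleCat.of R R) < ⊤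

/-- An AB ring is a Gorenstein local ring such that for all finitely generated modules `M` and `N`
with `Ext^i(M, N) = 0` for all `i ≫ 0` one has `Ext^i(M, N) = 0` for all `i > dim R`. -/
structure IsABRing (R : Type u) [CommRing R] : Prop extends IsGorensteinLocalRing R where
  ext_eq_zero : ∀ M N : ModuleCat.{u} R, Module.Finite R M → Module.Finite R N →
    (∃ n : ℕ, ∀ i : ℕ, n ≤ i → Subsingleton (Abelian.Ext M N i)) →
    ∀ i : ℕ, ringKrullDim R < (i : WithBot ℕ∞) → Subsingleton (Abelian.Ext M N i)

end QuasiProj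

/-! Let t = depth R, let P be a finite quasi-projective resolution of M, and put C_i = P_i/B_i,
where B_i denotes the boundaries. Two exact sequences, 0 → B_i → P_i → C_i → 0 and 0 → H_{i+1} →
C_{i+1} → B_i → 0, carry both halves of the theorem. With h the top homological degree, M embeds in
H_h and hence in C_h, and C_h has finite projective dimension.

(1) The terms of P need not be finitely generated, but C_h is finitely generated up to projective
summands. Auslander–Buchsbaum then embeds M into X ⊕ Q with X finitely generated, pd X ≤ t and Q
projective. For M = Tr Ω^t k, every map to such an X factors through a free module
(`IsSyzygy.exists_factorization`), so Tr Ω^t k is torsionless. The kernel of biduality on Tr Ω is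
Ext^1(Ω, R), hence Ext^{t+1}(k, R) = 0. At t = depth R this single vanishing already forces id R ≤ t
(`hasInjectiveDimensionLT_of_subsingleton_ext_residueField`).

(2) By (1), id R ≤ t, so Ext^i(C_h, N) = 0 for i > t and N finitely generated. If Ext^i(M, N) = 0
for all i > r, with r > t, climbing P from below gives Ext^{r+1}(B_{h-1}, N) = 0. Together with
Ext^r(C_h, N) = 0 this gives Ext^r(H_h, N) = 0, hence Ext^r(M, N) = 0. Descending induction reaches
every r > t, and t ≤ dim R. -/

namespace QuasiProj
open Abelian RingTheory.Sequence

/-! ### Long exact Ext sequences and Rees's lemma. -/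

section LongExactSequence

variable {R : Type u} [CommRing R] {S : ShortComplex (ModuleCat.{u} R)}

theorem subsingleton_ext_contra_X₂ (hS : S.ShortExact) (N : ModuleCat.{u} R) (n : ℕ)
    (h₁ : Subsingleton (Ext S.X₁ N n))
    (h₃ : Subsingleton (Ext S.X₃ N n)) : Subsingleton (Ext S.X₂ N n) := by
  refine subsingleton_of_forall_eq 0 fun x => ?_
  obtain ⟨y, rfl⟩ := Ext.contravariant_sequence_exact₂ hS N x (Subsingleton.elim _ _)
  rw [Subsingleton.elim y 0, Ext.comp_zero]

theorem subsingleton_ext_contra_X₃ (hS : S.ShortExact) (N : ModuleCat.{u} R) (n : ℕ)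
    (h₁ : Subsingleton (Ext S.X₁ N n))
    (h₂ : Subsingleton (Ext S.X₂ N (n + 1))) : Subsingleton (Ext S.X₃ N (n + 1)) := by
  refine subsingleton_of_forall_eq 0 fun x => ?_
  obtain ⟨y, rfl⟩ := Ext.contravariant_sequence_exact₃ hS N x (Subsingleton.elim _ _) (add_comm 1 n)
  rw [Subsingleton.elim y 0, Ext.comp_zero]

theorem subsingleton_ext_contra_X₁ (hS : S.ShortExact) (N : ModuleCat.{u} R) (n : ℕ)
    (h₂ : Subsingleton (Ext S.X₂ N n))
    (h₃ : Subsingleton (Ext S.X₃ N (n + 1))) : Subsingleton (Ext S.X₁ N n) := by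
  refine subsingleton_of_forall_eq 0 fun x => ?_
  obtain ⟨y, rfl⟩ := Ext.contravariant_sequence_exact₁ hS N x (add_comm 1 n) (Subsingleton.elim _ _)
  rw [Subsingleton.elim y 0, Ext.comp_zero]

theorem subsingleton_ext_co_X₃ (hS : S.ShortExact) (N : ModuleCat.{u} R) (n : ℕ)
    (h₂ : Subsingleton (Ext N S.X₂ n))
    (h₁ : Subsingleton (Ext N S.X₁ (n + 1))) : Subsingleton (Ext N S.X₃ n) := by
  refine subsingleton_of_forall_eq 0 fun x => ?_
  obtain ⟨y, rfl⟩ := Ext.covariant_sequence_exact₃ N hS x rfl (Subsingleton.elim _ _)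
  rw [Subsingleton.elim y 0, Ext.zero_comp]

theorem subsingleton_ext_co_X₁ (hS : S.ShortExact) (N : ModuleCat.{u} R) (n : ℕ)
    (h₃ : Subsingleton (Ext N S.X₃ n))
    (h : ∀ x : Ext N S.X₁ (n + 1), x.comp (Ext.mk₀ S.f) (add_zero _) = 0) :
    Subsingleton (Ext N S.X₁ (n + 1)) := by
  refine subsingleton_of_forall_eq 0 fun x => ?_
  obtain ⟨y, rfl⟩ := Ext.covariant_sequence_exact₁ N hS x (h x) rfl
  rw [Subsingleton.elim y 0, Ext.zero_comp]

theorem bijective_comp_extClass (hS : S.ShortExact) (N : ModuleCat.{u} R) (n : ℕ)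
    (h₂ : Subsingleton (Ext N S.X₂ n))
    (h : ∀ x : Ext N S.X₁ (n + 1), x.comp (Ext.mk₀ S.f) (add_zero _) = 0) :
    Function.Bijective (fun x : Ext N S.X₃ n => x.comp hS.extClass (rfl : n + 1 = n + 1)) := by
  constructor
  · refine (injective_iff_map_eq_zero
      (hS.extClass.postcomp N (rfl : n + 1 = n + 1))).mpr fun x hx => ?_
    obtain ⟨z, rfl⟩ := Ext.covariant_sequence_exact₃ N hS x rfl hx
    rw [Subsingleton.elim z 0, Ext.zero_comp]
  · intro x
    exact Ext.covariant_sequence_exact₁ N hS x (h x) rfl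

end LongExactSequence

variable {R : Type u} [CommRing R]

/-- For a weakly `L`-regular sequence `rs`, the functors `Hom(-, L/rs L)` and `Ext^n(-, L)` are
isomorphic on modules killed by `rs`, via composition with an extension class. -/
theorem exists_ext_forall_bijective (rs : List R) : ∀ (L : ModuleCat.{u} R),
    IsWeaklyRegular L rs →
    ∃ c : Ext (ModuleCat.of R (L ⧸ (Ideal.ofList rs • ⊤ : Submodule R L))) L rs.length,
      ∀ N : ModuleCat.{u} R, (∀ r ∈ rs, r ∈ Module.annihilator R N) →
        (∀ i < rs.length, Subsingleton (Ext N L i)) ∧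
        Function.Bijective (fun f : N ⟶ ModuleCat.of R
          (L ⧸ (Ideal.ofList rs • ⊤ : Submodule R L)) => (Ext.mk₀ f).comp c (zero_add _)) := by
  induction rs with
  | nil =>
    intro L _
    let e : (L ⧸ (Ideal.ofList [] • ⊤ : Submodule R L)) ≃ₗ[R] L :=
      Submodule.quotEquivOfEqBot _ (by rw [Ideal.ofList_nil (R := R), Submodule.bot_smul])
    refine ⟨Ext.mk₀ e.toModuleIso.hom, fun N _ => ⟨by simp, ?_⟩⟩
    have : (fun f : N ⟶ ModuleCat.of R (L ⧸ (Ideal.ofList [] • ⊤ : Submodule R L)) =>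
        (Ext.mk₀ f).comp (Ext.mk₀ e.toModuleIso.hom) (zero_add 0)) =
        fun f => Ext.mk₀ (f ≫ e.toModuleIso.hom) := by
      funext f; simp
    refine (congrArg Function.Bijective this).mpr ((Ext.mk₀_bijective N L).comp ?_)
    exact (e.toModuleIso.homToEquiv (Z := N)).bijective
  | cons r rs ih =>
    intro L h
    rw [isWeaklyRegular_cons_iff] at h
    obtain ⟨c, hc⟩ := ih (ModuleCat.of R (QuotSMulTop r L)) h.2
    have hS := h.1.smulShortComplex_shortExact
    let e := (Submodule.quotOfListConsSMulTopEquivQuotSMulTopInner L r rs).toModuleIso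
    let δ : Ext (ModuleCat.of R (QuotSMulTop r L)) L 1 := hS.extClass
    refine ⟨((Ext.mk₀ e.hom).comp c (zero_add _)).comp δ rfl, fun N hN => ?_⟩
    obtain ⟨hv, hb⟩ := hc N fun x hx => hN x (List.mem_cons_of_mem _ hx)
    -- By bilinearity, multiplication by `r` on `L` acts on Ext as multiplication by `r` on `N`,
    -- which is zero.
    have hr (i : ℕ) (x : Ext N L i) :
        x.comp (Ext.mk₀ (L.smulShortComplex r).f) (add_zero i) = 0 := by
      change x.comp (Ext.mk₀ (r • 𝟙 L)) (add_zero i) = 0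
      rw [Ext.mk₀_smul, Ext.comp_smul, Ext.comp_mk₀_id]
      have hN0 : r • 𝟙 N = 0 := by
        exact ModuleCat.hom_ext (LinearMap.ext (Module.mem_annihilator.mp (hN r List.mem_cons_self)))
      rw [← Ext.mk₀_id_comp (r • x), Ext.comp_smul, ← Ext.smul_comp, ← Ext.mk₀_smul, hN0,
        Ext.mk₀_zero, Ext.zero_comp]
    have hlt : ∀ i < (r :: rs).length, Subsingleton (Ext N L i) := by
      rintro (_ | i) hi
      · refine subsingleton_of_forall_eq 0 fun x => ?_
        have := hS.mono_f
        refine Ext.postcomp_mk₀_injective_of_mono N (L.smulShortComplex r).f ?_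
        exact (hr 0 x).trans (Ext.zero_comp (h := add_zero 0) ..).symm
      · exact subsingleton_ext_co_X₁ hS N i (hv i (by simpa using hi)) (hr _)
    refine ⟨hlt, ?_⟩
    have h1 : Function.Bijective (fun x : Ext N (ModuleCat.of R (QuotSMulTop r L)) rs.length =>
        x.comp δ (rfl : rs.length + 1 = rs.length + 1)) :=
      bijective_comp_extClass hS N rs.length (hlt _ (by simp)) (hr _)
    refine (congrArg Function.Bijective ?_).mp (h1.comp (hb.comp (e.homToEquiv (Z := N)).bijective))
    funext f
    simp only [Function.comp_apply, Iso.homToEquiv_apply]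
    rw [← Ext.mk₀_comp_mk₀_assoc]
    apply Ext.comp_assoc
    lia
end QuasiProj

/-! ### Testing Ext and injective dimension on cyclic modules and on the residue field. -/

namespace QuasiProj
open Abelian RingTheory.Sequence IsLocalRing

variable {R : Type u} [CommRing R]

theorem subsingleton_ext_of_retract {X Y : ModuleCat.{u} R} (r : Retract X Y) (L : ModuleCat.{u} R)
    (i : ℕ) (h : Subsingleton (Ext Y L i)) : Subsingleton (Ext X L i) := by
  refine subsingleton_of_forall_eq 0 fun x => ?_
  rw [← Ext.mk₀_id_comp x, ← r.retract, ← Ext.mk₀_comp_mk₀_assoc,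
    Subsingleton.elim ((Ext.mk₀ r.r).comp x (zero_add i)) 0, Ext.comp_zero]

/-- Dévissage along a prime filtration: annihilators only grow on submodules and quotients, so only
primes containing `J` occur as factors. -/
theorem subsingleton_ext_of_forall_prime [IsNoetherianRing R] (J : Ideal R) (L : ModuleCat.{u} R)
    (i : ℕ) (h : ∀ p : Ideal R, p.IsPrime → J ≤ p → Subsingleton (Ext (ModuleCat.of R (R ⧸ p)) L i))
    (N : Type u) [AddCommGroup N] [Module R N] (hfin : Module.Finite R N)
    (hN : J ≤ Module.annihilator R N) : Subsingleton (Ext (ModuleCat.of R N) L i) := by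
  revert hN
  induction hfin using IsNoetherianRing.induction_on_isQuotientEquivQuotientPrime R with
  | subsingleton N =>
    intro _
    have := (ModuleCat.isZero_of_subsingleton (ModuleCat.of R N)).hasProjectiveDimensionLT_zero
    exact HasProjectiveDimensionLT.subsingleton (ModuleCat.of R N) 0 i (Nat.zero_le i) L
  | quotient N p e =>
    intro hN
    have := h p.asIdeal p.isPrime (by rwa [e.annihilator_eq, Ideal.annihilator_quotient] at hN)
    exact subsingleton_ext_of_retract e.toModuleIso.retract L i this
  | exact N₁ N₂ N₃ f g hf hg hfg h₁ h₃ =>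
    intro hN
    exact subsingleton_ext_contra_X₂ (ModuleCat.shortComplex_shortExact
      (ModuleCat.shortComplexOfCompEqZero f g hfg.linearMap_comp_eq_zero) hfg hf hg) L i
      (h₁ (hN.trans (f.annihilator_le_of_injective hf)))
      (h₃ (hN.trans (g.annihilator_le_of_surjective hg)))

/-- Baer's criterion is the case `t = 0`; the rest is dimension shifting along an embedding into an
injective. -/
theorem hasInjectiveDimensionLT_of_subsingleton_ext_quotient (t : ℕ) : ∀ (L : ModuleCat.{u} R),
    (∀ I : Ideal R, Subsingleton (Ext (ModuleCat.of R (R ⧸ I)) L (t + 1))) →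
    HasInjectiveDimensionLT L (t + 1) := by
  induction t with
  | zero =>
    intro L h
    rw [zero_add, ← injective_iff_hasInjectiveDimensionLT_one,
      ← Module.injective_iff_injective_object R L, ← Module.Baer.iff_injective]
    intro I f
    have hS := ModuleCat.shortComplex_shortExact
      (ModuleCat.shortComplexOfCompEqZero I.subtype I.mkQ
        (LinearMap.exact_subtype_mkQ I).linearMap_comp_eq_zero)
      (LinearMap.exact_subtype_mkQ I) I.injective_subtype I.mkQ_surjective
    obtain ⟨y, hy⟩ := Ext.contravariant_sequence_exact₁ hS L (Ext.mk₀ (ModuleCat.ofHom f))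
      (add_comm 1 0) (@Subsingleton.elim _ (h I) _ _)
    obtain ⟨g, rfl⟩ := (Ext.mk₀_bijective _ _).2 y
    rw [Ext.mk₀_comp_mk₀, (Ext.mk₀_bijective _ _).1.eq_iff] at hy
    exact ⟨g.hom, fun x hx => congr(($hy).hom ⟨x, hx⟩)⟩
  | succ t ih =>
    intro L h
    obtain ⟨I, _, f, _⟩ := EnoughInjectives.presentation L
    have hS : (ShortComplex.mk f (Limits.cokernel.π f) (Limits.cokernel.condition f)).ShortExact :=
      { exact := ShortComplex.exact_cokernel f }
    refine (hS.hasInjectiveDimensionLT_X₃_iff t inferInstance).mp (ih _ fun J => ?_)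
    exact subsingleton_ext_co_X₃ hS _ _
      (HasInjectiveDimensionLT.subsingleton I 1 (t + 1) (by lia) _) (h J)

/-- Noetherian induction on primes, from larger to smaller. For x in the maximal ideal but not in p,
the module R/(p, x) is filtered by strictly larger primes, so its Ext^{i+1} vanishes. Hence x acts
surjectively on the finitely generated module Ext^i(R/p, L), which is zero by Nakayama. -/
theorem subsingleton_ext_of_residueField [IsLocalRing R] [IsNoetherianRing R]
    (L : ModuleCat.{u} R) [Module.Finite R L] (t : ℕ)
    (h : ∀ i, t < i → Subsingleton (Ext (ModuleCat.of R (ResidueField R)) L i))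
    (N : Type u) [AddCommGroup N] [Module R N] [hN : Module.Finite R N] (i : ℕ) (hi : t < i) :
    Subsingleton (Ext (ModuleCat.of R N) L i) := by
  suffices H : ∀ p : Ideal R, p.IsPrime → ∀ i, t < i →
      Subsingleton (Ext (ModuleCat.of R (R ⧸ p)) L i) from
    subsingleton_ext_of_forall_prime ⊥ L i (fun p hp _ => H p hp i hi) N hN bot_le
  intro p
  induction p using WellFoundedGT.induction with
  | ind p ih =>
  intro hp i hi
  obtain rfl | hpm := eq_or_ne p (maximalIdeal R)
  · exact h i hi
  obtain ⟨x, hxm, hxp⟩ := SetLike.exists_of_lt ((le_maximalIdeal hp.ne_top).lt_of_ne hpm)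
  have hreg : IsSMulRegular (ModuleCat.of R (R ⧸ p)) x := by
    refine (isSMulRegular_iff_right_eq_zero_of_smul).mpr fun y hy => ?_
    obtain ⟨y, rfl⟩ := Ideal.Quotient.mk_surjective y
    change Ideal.Quotient.mk p (x * y) = 0 at hy
    rw [Ideal.Quotient.eq_zero_iff_mem] at hy ⊢
    exact (hp.mem_or_mem hy).resolve_left hxp
  have hS := hreg.smulShortComplex_shortExact
  have h₃ : Subsingleton (Ext (ModuleCat.of R (QuotSMulTop x (R ⧸ p))) L (i + 1)) := by
    refine subsingleton_ext_of_forall_prime (p ⊔ Ideal.span {x}) L (i + 1)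
      (fun q hq hpq => ?_) _ inferInstance ?_
    · refine ih q ?_ hq (i + 1) (by lia)
      exact (le_sup_left.trans hpq).lt_of_ne fun h => hxp (h ▸ hpq (Ideal.mem_sup_right
        (Ideal.mem_span_singleton_self x)))
    · refine sup_le ?_ ((Ideal.span_singleton_le_iff_mem _).mpr (QuotSMulTop.mem_annihilator _ x))
      exact (Ideal.annihilator_quotient (I := p)).ge.trans
        (LinearMap.annihilator_le_of_surjective (Submodule.mkQ _) (Submodule.mkQ_surjective _))
  by_contra hne
  rw [not_subsingleton_iff_nontrivial] at hne
  have hx : x ∈ (Module.annihilator R (Ext (ModuleCat.of R (R ⧸ p)) L i)).jacobson :=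
    (maximalIdeal_le_jacobson _) hxm
  refine Submodule.top_ne_pointwise_smul_of_mem_jacobson_annihilator hx (top_unique fun y _ => ?_).symm
  obtain ⟨z, hz⟩ := Ext.contravariant_sequence_exact₁ hS L y (add_comm 1 i)
    (@Subsingleton.elim _ h₃ _ _)
  refine (Submodule.mem_smul_pointwise_iff_exists _ _ _).mpr ⟨z, trivial, ?_⟩
  have key (w : Ext (ModuleCat.of R (R ⧸ p)) L i) :
      (Ext.mk₀ (x • 𝟙 (ModuleCat.of R (R ⧸ p)))).comp w (zero_add i) = x • w := by
    rw [Ext.mk₀_smul, Ext.smul_comp, Ext.mk₀_id_comp]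
  exact (key z).symm.trans hz

end QuasiProj

/-! ### Vanishing of Ext^{t+1}(k, R) at t = depth R bounds the injective dimension of R. -/

namespace QuasiProj
open Abelian RingTheory.Sequence IsLocalRing

variable {R : Type u} [CommRing R]

/-- A nonzero finitely generated module killed by the maximal ideal has a nonzero map to the
residue field. -/
theorem exists_surjective_residueField [IsLocalRing R] (N : Type u) [AddCommGroup N] [Module R N]
    [Module.Finite R N] [Nontrivial N] :
    ∃ f : N →ₗ[R] ResidueField R, Function.Surjective f := by
  obtain ⟨q, hq, -⟩ := (eq_top_or_exists_le_coatom (⊥ : Submodule R N)).resolve_left bot_ne_top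
  have : IsSimpleModule R (N ⧸ q) := isSimpleModule_iff_isCoatom.mpr hq
  obtain ⟨I, hI, ⟨e⟩⟩ := isSimpleModule_iff_quot_maximal.mp this
  obtain rfl := eq_maximalIdeal hI
  exact ⟨e.toLinearMap ∘ₗ q.mkQ, e.surjective.comp q.mkQ_surjective⟩

theorem exists_isRegular_length_eq_depth [IsLocalRing R] (t : ℕ) (ht : depth R = t) :
    ∃ rs : List R, rs.length = t ∧ (∀ r ∈ rs, r ∈ maximalIdeal R) ∧ IsRegular R rs := by
  have hmem : depth R ∈ {d : ℕ∞ | ∃ rs : List R, (∀ r ∈ rs, r ∈ maximalIdeal R) ∧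
      IsRegular R rs ∧ d = rs.length} :=
    @ENat.sSup_mem_of_nonempty_of_lt_top _ ⟨0, [], by simp, IsRegular.nil R R, by simp⟩
      (ht.trans_lt (ENat.natCast_lt_top t))
  obtain ⟨rs, hm, hreg, hlen⟩ := hmem
  exact ⟨rs, by exact_mod_cast (ht.symm.trans hlen).symm, hm, hreg⟩

variable [IsLocalRing R] [IsNoetherianRing R]

theorem subsingleton_ext_of_pow_le_annihilator (L : ModuleCat.{u} R) (i n : ℕ)
    (h : Subsingleton (Ext (ModuleCat.of R (ResidueField R)) L i))
    (N : Type u) [AddCommGroup N] [Module R N] [Module.Finite R N]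
    (hN : maximalIdeal R ^ n ≤ Module.annihilator R N) : Subsingleton (Ext (ModuleCat.of R N) L i) := by
  refine subsingleton_ext_of_forall_prime _ L i (fun p hp hnp => ?_) N inferInstance hN
  obtain rfl := ((maximalIdeal.isMaximal R).eq_of_le hp.ne_top (hp.le_of_pow_le hnp)).symm
  exact h

/-- If `Ext^(t+1)(k, R) = 0`, where `t` is the length of the weakly regular sequence `rs`, then
`R/(rs)` is injective relative to modules of finite length killed by `rs`. -/
theorem exists_extension_of_finiteLength (rs : List R) (hreg : IsWeaklyRegular R rs)
    (h : Subsingleton (Ext (ModuleCat.of R (ResidueField R)) (ModuleCat.of R R) (rs.length + 1)))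
    (n : ℕ) {N N' : Type u} [AddCommGroup N] [Module R N]
    [AddCommGroup N'] [Module R N'] [Module.Finite R N]
    (hn : maximalIdeal R ^ n ≤ Module.annihilator R N) (hrs : ∀ r ∈ rs, r ∈ Module.annihilator R N)
    (i : N' →ₗ[R] N) (hi : Function.Injective i)
    (f : N' →ₗ[R] R ⧸ (Ideal.ofList rs • ⊤ : Submodule R R)) :
    ∃ g : N →ₗ[R] R ⧸ (Ideal.ofList rs • ⊤ : Submodule R R), g ∘ₗ i = f := by
  obtain ⟨c, hc⟩ := exists_ext_forall_bijective rs (ModuleCat.of R R) hreg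
  have hS := ModuleCat.shortComplex_shortExact
    (ModuleCat.shortComplexOfCompEqZero i i.range.mkQ i.exact_map_mkQ_range.linearMap_comp_eq_zero)
    i.exact_map_mkQ_range hi i.range.mkQ_surjective
  have hQ : Subsingleton (Ext (ModuleCat.of R (N ⧸ i.range)) (ModuleCat.of R R) (rs.length + 1)) :=
    subsingleton_ext_of_pow_le_annihilator _ _ n h _
      (hn.trans (i.range.mkQ.annihilator_le_of_surjective i.range.mkQ_surjective))
  -- Under Rees's isomorphism `f` becomes a class in Ext^t(N', R); the obstruction to extending it
  -- to `N` lies in Ext^{t+1}(N/N', R) = 0.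
  obtain ⟨y, hy⟩ := Ext.contravariant_sequence_exact₁ hS (ModuleCat.of R R)
    ((Ext.mk₀ (ModuleCat.ofHom f)).comp c (zero_add _)) (add_comm 1 _)
    (@Subsingleton.elim _ hQ _ _)
  obtain ⟨g, hg⟩ := (hc (ModuleCat.of R N) hrs).2.2 y
  have hinj := (hc (ModuleCat.of R N')
    fun r hr => i.annihilator_le_of_injective hi (hrs r hr)).2.1
  refine ⟨g.hom, ?_⟩
  have : ModuleCat.ofHom i ≫ g = ModuleCat.ofHom f := by
    refine hinj ?_
    change (Ext.mk₀ _).comp c _ = (Ext.mk₀ _).comp c _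
    rw [← Ext.mk₀_comp_mk₀_assoc]
    exact (congrArg (fun z => (Ext.mk₀ (ModuleCat.ofHom i)).comp z (zero_add _)) hg).trans hy
  exact congrArg ModuleCat.Hom.hom this

/-- If `Ext^(t+1)(k, R) = 0` and `Hom(k, R/(rs)) ≠ 0`, then `R/(rs)` has finite length. -/
theorem exists_pow_maximalIdeal_le (rs : List R) (hreg : IsWeaklyRegular R rs)
    (h : Subsingleton (Ext (ModuleCat.of R (ResidueField R)) (ModuleCat.of R R) (rs.length + 1)))
    (hsoc : ∃ f : ResidueField R →ₗ[R] R ⧸ (Ideal.ofList rs • ⊤ : Submodule R R), f ≠ 0) :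
    ∃ n, maximalIdeal R ^ n ≤ Ideal.ofList rs := by
  set m := maximalIdeal R
  set A := R ⧸ (Ideal.ofList rs • ⊤ : Submodule R R)
  let T : ℕ →o Submodule R A :=
    ⟨fun n => Submodule.torsionBySet R A (m ^ n : Ideal R), fun a b hab =>
      Submodule.torsionBySet_le_torsionBySet_of_subset (Ideal.pow_le_pow_right hab)⟩
  obtain ⟨n, hn⟩ := monotone_stabilizes_iff_noetherian.mpr (inferInstance : IsNoetherian R A) T
  refine ⟨n, ?_⟩
  -- By Nakayama it suffices that m^n ≤ (rs) + m^{n+1}. Otherwise the image N' of m^n in R/J is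
  -- nonzero and maps onto k, hence nontrivially to A, and this map extends to g on R/J. But g(1) is
  -- killed by m^{n+1}, hence by m^n since the torsion has stabilized, so g vanishes on N'.
  set J := Ideal.ofList rs ⊔ m ^ (n + 1)
  suffices H : m ^ n ≤ J by
    refine Submodule.le_of_le_smul_of_le_jacobson_bot (I := m) (IsNoetherian.noetherian _)
      (jacobson_eq_maximalIdeal ⊥ bot_ne_top).ge ?_
    rwa [smul_eq_mul, ← pow_succ']
  by_contra hJ
  let N' : Submodule R (R ⧸ J) := Submodule.map J.mkQ (m ^ n)
  have hN' : Nontrivial N' := by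
    rw [Submodule.nontrivial_iff_ne_bot]
    intro h0
    refine hJ fun x hx => ?_
    have : J.mkQ x ∈ N' := Submodule.mem_map_of_mem hx
    rw [h0, Submodule.mem_bot] at this
    exact (Submodule.Quotient.mk_eq_zero J).mp this
  obtain ⟨p, hp⟩ := exists_surjective_residueField (R := R) N'
  obtain ⟨s, hs⟩ := hsoc
  have hJann : Module.annihilator R (R ⧸ J) = J := Ideal.annihilator_quotient
  obtain ⟨g, hg⟩ := exists_extension_of_finiteLength rs hreg h (n + 1)
    (N := R ⧸ J) (le_sup_right.trans hJann.ge)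
    (fun r hr => hJann.ge (Ideal.mem_sup_left (Ideal.subset_span hr))) N'.subtype N'.injective_subtype
    (s ∘ₗ p)
  refine hs (LinearMap.ext fun z => ?_)
  obtain ⟨⟨w, hw⟩, rfl⟩ := hp z
  have hgw : s (p ⟨w, hw⟩) = g w := (congr($hg ⟨w, hw⟩)).symm
  rw [hgw]
  obtain ⟨x, hx, rfl⟩ := hw
  have hgm (a : R) : a • g (J.mkQ 1) = g (J.mkQ a) := by
    rw [← map_smul, ← map_smul]
    exact congrArg (fun b => g (J.mkQ b)) (mul_one a)
  have h1 : g (J.mkQ 1) ∈ T (n + 1) := by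
    refine (Submodule.mem_torsionBySet_iff _ _).mpr fun a => ?_
    rw [hgm]
    have : J.mkQ a.1 = 0 := (Submodule.Quotient.mk_eq_zero J).mpr (Ideal.mem_sup_right a.2)
    rw [this, map_zero]
  rw [← hn (n + 1) (Nat.le_succ n)] at h1
  have := (Submodule.mem_torsionBySet_iff _ _).mp h1 ⟨x, hx⟩
  exact (hgm x).symm.trans this

/-- The kernel of R/(rs) → k is killed by a power of the maximal ideal, so Ext^i(k, R) = 0 passes to
it. Since R/(rs) has projective dimension t, the long exact sequence then gives Ext^{i+1}(k, R) = 0.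
-/
theorem subsingleton_ext_residueField_of_length_lt (rs : List R) (hreg : IsWeaklyRegular R rs)
    (h : Subsingleton (Ext (ModuleCat.of R (ResidueField R)) (ModuleCat.of R R) (rs.length + 1)))
    (hsoc : ∃ f : ResidueField R →ₗ[R] R ⧸ (Ideal.ofList rs • ⊤ : Submodule R R), f ≠ 0)
    (hm : ∀ r ∈ rs, r ∈ maximalIdeal R) (i : ℕ) (hi : rs.length < i) :
    Subsingleton (Ext (ModuleCat.of R (ResidueField R)) (ModuleCat.of R R) i) := by
  obtain ⟨n, hn⟩ := exists_pow_maximalIdeal_le rs hreg h hsoc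
  induction i, hi using Nat.le_induction with
  | base => exact h
  | succ i hi ih =>
    have hle : (Ideal.ofList rs • ⊤ : Submodule R R) ≤ maximalIdeal R := by
      rw [smul_eq_mul, Ideal.mul_top]
      exact Ideal.span_le.mpr hm
    let π := Submodule.factor hle
    have hπ : Function.Surjective π := Submodule.factor_surjective hle
    refine subsingleton_ext_contra_X₃ (LinearMap.shortExact_shortComplexKer hπ) _ i ?_ ?_
    · refine subsingleton_ext_of_pow_le_annihilator _ i n ih _ ?_
      refine le_trans ?_ ((LinearMap.ker π).subtype.annihilator_le_of_injective
        (Submodule.injective_subtype _))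
      rw [Ideal.annihilator_quotient, smul_eq_mul, Ideal.mul_top]
      exact hn
    · have hpd := ModuleCat.projectiveDimension_quotient_eq_add_length_of_isWeaklyRegular
        (ModuleCat.of R R) rs hreg hm
      rw [ModuleCat.projectiveDimension_eq_zero_of_projective (ModuleCat.of R R), zero_add] at hpd
      have := (projectiveDimension_le_iff _ _).mp hpd.le
      exact HasProjectiveDimensionLT.subsingleton _ (rs.length + 1) (i + 1) (by lia) _

/-- If the socle of R/(rs) were zero, Rees's lemma would kill Ext^i(k, R) for all i ≤ t and produce
a regular sequence of length t + 1. -/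
theorem exists_hom_residueField_ne_zero (rs : List R) (hlen : depth R = rs.length)
    (hm : ∀ r ∈ rs, r ∈ maximalIdeal R) (hreg : IsRegular R rs) :
    ∃ f : ResidueField R →ₗ[R] R ⧸ (Ideal.ofList rs • ⊤ : Submodule R R), f ≠ 0 := by
  have hann : Module.annihilator R (ResidueField R) = maximalIdeal R := Ideal.annihilator_quotient
  obtain ⟨c, hc⟩ := exists_ext_forall_bijective rs (ModuleCat.of R R) hreg.1
  obtain ⟨hlt, hb⟩ := hc (ModuleCat.of R (ResidueField R)) fun r hr => hann.ge (hm r hr)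
  by_contra! hzero
  have hfin : Module.Finite R (ResidueField R) := inferInstanceAs (Module.Finite R (R ⧸ maximalIdeal R))
  obtain ⟨rs', hlen', hm', hreg'⟩ := ModuleCat.exists_isRegular_of_exists_subsingleton_ext
    (maximalIdeal R) (rs.length + 1) (ModuleCat.of R R)
    (by
      rw [smul_eq_mul, Ideal.mul_top]
      exact lt_top_iff_ne_top.mpr (maximalIdeal.isMaximal R).ne_top)
    (ModuleCat.of R (ResidueField R))
    (by rw [Module.support_eq_zeroLocus, hann])
    (fun i hi => by
      rcases Nat.lt_succ_iff_lt_or_eq.mp hi with hi | rfl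
      · exact hlt i hi
      · refine @Function.Surjective.subsingleton _ _ _ ⟨fun f g => ModuleCat.hom_ext ?_⟩ hb.2
        rw [hzero f.hom, hzero g.hom])
  have : (rs'.length : ℕ∞) ≤ depth R := le_sSup ⟨rs', hm', hreg', rfl⟩
  rw [hlen, hlen'] at this
  exact absurd (by exact_mod_cast this) (Nat.not_succ_le_self rs.length)

/-- If `Ext^(t+1)(k, R) = 0` where `t = depth R`, then `R` has injective dimension at most `t`. -/
theorem hasInjectiveDimensionLT_of_subsingleton_ext_residueField (t : ℕ) (ht : depth R = t)
    (h : Subsingleton (Ext (ModuleCat.of R (ResidueField R)) (ModuleCat.of R R) (t + 1))) :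
    HasInjectiveDimensionLT (ModuleCat.of R R) (t + 1) := by
  obtain ⟨rs, rfl, hm, hreg⟩ := exists_isRegular_length_eq_depth t ht
  refine hasInjectiveDimensionLT_of_subsingleton_ext_quotient _ _ fun I => ?_
  refine subsingleton_ext_of_residueField _ rs.length (fun i hi => ?_) _ _ (Nat.lt_succ_self _)
  exact subsingleton_ext_residueField_of_length_lt rs hreg.1 h
    (exists_hom_residueField_ne_zero rs ht hm hreg) hm i hi

end QuasiProj

/-! ### Syzygies, transposes and torsionlessness. -/

namespace QuasiProj
open Abelian

variable {R : Type u} [CommRing R]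

theorem IsSyzygy.subsingleton_ext {M : ModuleCat.{u} R} (L : ModuleCat.{u} R) (n : ℕ) :
    ∀ (X : ModuleCat.{u} R) (i : ℕ), IsSyzygy R M n X → Subsingleton (Ext X L (i + 1)) →
      Subsingleton (Ext M L (n + i + 1)) := by
  induction n with
  | zero =>
    rintro X i ⟨e⟩ h
    rw [zero_add]
    exact subsingleton_ext_of_retract e.toModuleIso.symm.retract L (i + 1) h
  | succ n ih =>
    rintro X i ⟨Y, hY, F, f, hF, hproj, hf, ⟨e⟩⟩ h
    have hS := LinearMap.shortExact_shortComplexKer hf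
    have := ih Y (i + 1) hY (subsingleton_ext_contra_X₃ hS L (i + 1)
      (subsingleton_ext_of_retract e.toModuleIso.symm.retract L (i + 1) h) ?_)
    · rwa [Nat.add_right_comm n 1 i]
    · have : Projective F := by rwa [← IsProjective.iff_projective]
      exact Ext.subsingleton_of_projective F L (i + 1)

/-- A class in Ext^1(Ω, R) comes from a functional on the kernel of `g`, and it vanishes once that
functional extends to `P₀`. Pulling back along `P₁` turns extension into membership in the range of
the dual map. -/
theorem subsingleton_ext_one_of_forall_dual {P₁ P₀ Ω : ModuleCat.{u} R} (f : P₁ →ₗ[R] P₀)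
    (g : P₀ →ₗ[R] Ω) [Module.Projective R P₀] (hfg : Function.Exact f g)
    (hg : Function.Surjective g)
    (h : ∀ φ : Module.Dual R P₁, (∀ x, f x = 0 → φ x = 0) → φ ∈ LinearMap.range f.dualMap) :
    Subsingleton (Ext Ω (ModuleCat.of R R) 1) := by
  refine subsingleton_of_forall_eq 0 fun x => ?_
  have : Projective P₀ := by rwa [← IsProjective.iff_projective]
  have hS := LinearMap.shortExact_shortComplexKer hg
  obtain ⟨y, rfl⟩ := Ext.contravariant_sequence_exact₃ hS (ModuleCat.of R R) x
    (@Subsingleton.elim _ (Ext.subsingleton_of_projective P₀ _ 0) _ _) (add_comm 1 0)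
  obtain ⟨φ, rfl⟩ := (Ext.mk₀_bijective _ _).2 y
  let f' : P₁ →ₗ[R] LinearMap.ker g := f.codRestrict _ fun x => hfg.apply_apply_eq_zero x
  obtain ⟨ψ, hψ⟩ := h (φ.hom ∘ₗ f') fun x hx => by
    have : f' x = 0 := Subtype.ext hx
    rw [LinearMap.comp_apply, this, map_zero]
  have hφ : φ = ModuleCat.ofHom (LinearMap.ker g).subtype ≫ ModuleCat.ofHom ψ := by
    refine ModuleCat.hom_ext (LinearMap.ext fun z => ?_)
    obtain ⟨w, hw⟩ := (hfg z.1).mp z.2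
    obtain rfl : f' w = z := Subtype.ext hw
    exact (congr($hψ w)).symm
  rw [hφ, ← Ext.mk₀_comp_mk₀]
  exact hS.extClass_comp_assoc _

/-- By reflexivity of `P₁`, a functional on `T` is evaluation at some p in `P₁`, and it kills the
range of the dual map exactly when f p = 0. So the class of `φ` is killed by every functional on
`T`. -/
theorem mem_range_dualMap_of_torsionless {P₁ P₀ : Type u} [AddCommGroup P₁] [Module R P₁]
    [AddCommGroup P₀] [Module R P₀] [Module.Finite R P₁] [Module.Projective R P₁]
    [Module.Projective R P₀] (f : P₁ →ₗ[R] P₀) {T : Type u} [AddCommGroup T] [Module R T]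
    (e : T ≃ₗ[R] (Module.Dual R P₁ ⧸ LinearMap.range f.dualMap))
    (hT : ∀ x : T, (∀ θ : Module.Dual R T, θ x = 0) → x = 0)
    (φ : Module.Dual R P₁) (hφ : ∀ x, f x = 0 → φ x = 0) : φ ∈ LinearMap.range f.dualMap := by
  rw [← Submodule.Quotient.mk_eq_zero, ← e.symm.map_eq_zero_iff]
  refine hT _ fun θ => ?_
  obtain ⟨p, hp⟩ := (Module.evalEquiv R P₁).surjective
    (θ ∘ₗ e.symm.toLinearMap ∘ₗ (LinearMap.range f.dualMap).mkQ)
  have hval (ξ : Module.Dual R P₁) : θ (e.symm (Submodule.Quotient.mk ξ)) = ξ p :=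
    (congr($hp ξ)).symm
  rw [hval]
  refine hφ p ((Module.forall_dual_apply_eq_zero_iff R _).mp fun ψ => ?_)
  rw [← LinearMap.dualMap_apply, ← hval,
    (Submodule.Quotient.mk_eq_zero _).mpr (LinearMap.mem_range_self _ ψ), map_zero, map_zero]

/-- A map from the transpose of an `n`-th syzygy to a module of projective dimension at most `n`
factors through a finitely generated free module. The map is given by a map on the dual of the
module of relations. -/
theorem IsSyzygy.exists_factorization [IsNoetherianRing R] {M : ModuleCat.{u} R} (n : ℕ) :
    ∀ {Ω P₁ P₀ : ModuleCat.{u} R}, IsSyzygy R M n Ω → ∀ (f : P₁ →ₗ[R] P₀) (g : P₀ →ₗ[R] Ω)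
      [Module.Finite R P₁] [Module.Projective R P₁] [Module.Finite R P₀] [Module.Projective R P₀],
      Function.Exact f g → Function.Surjective g →
      ∀ (X : Type u) [AddCommGroup X] [Module R X] [Module.Finite R X],
      HasProjectiveDimensionLT (ModuleCat.of R X) (n + 1) →
      ∀ φ : Module.Dual R P₁ →ₗ[R] X, φ ∘ₗ f.dualMap = 0 →
      ∃ (j : ℕ) (α : Module.Dual R P₁ →ₗ[R] Fin j → R) (β : (Fin j → R) →ₗ[R] X),
        α ∘ₗ f.dualMap = 0 ∧ β ∘ₗ α = φ := by
  induction n with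
  | zero =>
    intro Ω P₁ P₀ _ f g _ _ _ _ _ _ X _ _ _ hX φ hφ
    obtain ⟨j, π, hπ⟩ := Module.Finite.exists_fin' R X
    have : Module.Projective R X := by
      rw [zero_add, ← projective_iff_hasProjectiveDimensionLT_one] at hX
      rwa [IsProjective.iff_projective]
    obtain ⟨s, hs⟩ := Module.projective_lifting_property π LinearMap.id hπ
    refine ⟨j, s ∘ₗ φ, π, ?_, ?_⟩
    · rw [LinearMap.comp_assoc, hφ, LinearMap.comp_zero]
    · rw [← LinearMap.comp_assoc, hs, LinearMap.id_comp]
  | succ n ih =>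
    rintro Ω P₁ P₀ ⟨Y, hY, G, p, hG, hGproj, hp, ⟨e⟩⟩ f g _ _ _ _ hfg hg X _ _ _ hX φ hφ
    obtain ⟨k, π, hπ⟩ := Module.Finite.exists_fin' R X
    have hS := LinearMap.shortExact_shortComplexKer hπ
    have hK : HasProjectiveDimensionLT (ModuleCat.of R (LinearMap.ker π)) (n + 1) :=
      hS.hasProjectiveDimensionLT_X₁ (n + 1)
        (hasProjectiveDimensionLT_of_ge (ModuleCat.of R (Fin k → R)) 1 (n + 1) (by lia)) hX
    let g' : P₀ →ₗ[R] G := (LinearMap.ker p).subtype ∘ₗ e.toLinearMap ∘ₗ g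
    have hg' : Function.Exact g' p := by
      intro y
      constructor
      · intro hy
        obtain ⟨x, hx⟩ := hg (e.symm ⟨y, hy⟩)
        exact ⟨x, by simp [g', hx]⟩
      · rintro ⟨x, rfl⟩
        exact (e (g x)).2
    have hker (x : P₀) (hx : g' x = 0) : g x = 0 :=
      e.map_eq_zero_iff.mp (Subtype.ext hx)
    -- The lift `l` need not kill the range of `f.dualMap`. Its defect `μ` kills the range of
    -- `g'.dualMap`, so it is a map from the transpose of `Y` to a module of projective dimension
    -- one less, and induction applies.
    obtain ⟨l, hl⟩ := Module.projective_lifting_property π φ hπ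
    let μ : Module.Dual R P₀ →ₗ[R] LinearMap.ker π := (l ∘ₗ f.dualMap).codRestrict _ fun x => by
      have := congr($hφ x)
      rw [← hl] at this
      exact this
    have hμ : μ ∘ₗ g'.dualMap = 0 := by
      ext θ : 2
      have : f.dualMap (g'.dualMap θ) = 0 := by
        ext x
        have : g' (f x) = 0 := by simp [g', hfg.apply_apply_eq_zero x]
        simp [this]
      change l (f.dualMap (g'.dualMap θ)) = 0
      rw [this, map_zero]
    obtain ⟨j, α, β, hα, hβ⟩ := ih hY g' p hg' hp (LinearMap.ker π) hK μ hμ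
    -- Each coordinate of `α` is evaluation at a point of `P₀` killed by `g'`, hence in the image of
    -- `f`. So `α` factors as `γ ∘ₗ f.dualMap`, and subtracting `β ∘ₗ γ` from `l` removes the
    -- defect.
    have hq (c : Fin j) : ∃ q : P₁, ∀ ψ : Module.Dual R P₀, ψ (f q) = α ψ c := by
      obtain ⟨x, hx⟩ := (Module.evalEquiv R P₀).surjective (LinearMap.proj c ∘ₗ α)
      have hval (ψ : Module.Dual R P₀) : ψ x = α ψ c := congr($hx ψ)
      obtain ⟨q, rfl⟩ := (hfg x).mp (hker x
        ((Module.forall_dual_apply_eq_zero_iff R _).mp fun θ => by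
          rw [← LinearMap.dualMap_apply, hval]
          exact congr($hα θ c)))
      exact ⟨q, hval⟩
    choose q hq using hq
    let γ : Module.Dual R P₁ →ₗ[R] Fin j → R := LinearMap.pi fun c => Module.Dual.eval R P₁ (q c)
    have hγ : γ ∘ₗ f.dualMap = α := by
      ext ψ c
      exact hq c ψ
    refine ⟨k, l - (LinearMap.ker π).subtype ∘ₗ β ∘ₗ γ, π, ?_, ?_⟩
    · rw [LinearMap.sub_comp, LinearMap.comp_assoc, LinearMap.comp_assoc, hγ, hβ, sub_eq_zero]
      rfl
    · rw [LinearMap.comp_sub, hl, ← LinearMap.comp_assoc]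
      simp [LinearMap.comp_ker_subtype]

end QuasiProj

/-! ### The Auslander–Buchsbaum bound. -/

namespace QuasiProj
open Abelian IsLocalRing RingTheory.Sequence TensorProduct

variable {R : Type u} [CommRing R]

section AuslanderBuchsbaum

theorem _root_.RingTheory.Sequence.IsWeaklyRegular.take {M : Type u} [AddCommGroup M] [Module R M]
    {rs : List R} (h : IsWeaklyRegular M rs) (n : ℕ) : IsWeaklyRegular M (rs.take n) :=
  ((isWeaklyRegular_append_iff M (rs.take n) (rs.drop n)).mp (by rwa [List.take_append_drop])).1

theorem isWeaklyRegular_of_free {rs : List R} (h : IsWeaklyRegular R rs) (F : Type u)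
    [AddCommGroup F] [Module R F] [Module.Flat R F] : IsWeaklyRegular F rs :=
  ((TensorProduct.rid R F).isWeaklyRegular_congr rs).mp h.isWeaklyRegular_lTensor

/-- An elementwise form of Tor_1(R/(rs), Y) = 0. -/
theorem injective_mapQ_of_isWeaklyRegular {A F Y : Type u} [AddCommGroup A] [Module R A]
    [AddCommGroup F] [Module R F] [AddCommGroup Y] [Module R Y] {f : A →ₗ[R] F} {g : F →ₗ[R] Y}
    (hf : Function.Injective f) (hfg : Function.Exact f g) (hg : Function.Surjective g)
    {rs : List R} (h : IsWeaklyRegular Y rs) :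
    Function.Injective (Submodule.mapQ _ _ _
      (Submodule.smul_top_le_comap_smul_top (Ideal.ofList rs) f)) := by
  have := map_first_exact_on_four_term_right_exact_of_isSMulRegular_last
    (f₁ := (0 : PUnit.{u + 1} →ₗ[R] A)) (by simpa using hf) hfg hg h
  rw [Submodule.mapQ_zero] at this
  simpa using this

/-- Passing to a syzygy gains one step of regularity: only the proper prefixes of `rs` must be
regular on the quotient. -/
theorem isWeaklyRegular_of_forall_take {A F Y : Type u} [AddCommGroup A] [Module R A]
    [AddCommGroup F] [Module R F] [AddCommGroup Y] [Module R Y] {f : A →ₗ[R] F} {g : F →ₗ[R] Y}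
    (hf : Function.Injective f) (hfg : Function.Exact f g) (hg : Function.Surjective g)
    {rs : List R} (hF : IsWeaklyRegular F rs)
    (hY : ∀ i < rs.length, IsWeaklyRegular Y (rs.take i)) : IsWeaklyRegular A rs :=
  ⟨fun i hi => (hF.regular_mod_prev i hi).of_injective _
    (injective_mapQ_of_isWeaklyRegular hf hfg hg (hY i hi))⟩

variable [IsLocalRing R] [IsNoetherianRing R] {rs : List R}

/-- With k embedded in R/(rs) and `A` flat, k ⊗ A → (R/(rs)) ⊗ A → (R/(rs)) ⊗ F is injective, where
F is the free cover. Hence so is k ⊗ A → k ⊗ F, which makes `Y` free. -/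
theorem projective_of_isWeaklyRegular_of_hasProjectiveDimensionLT_two
    (hsoc : ∃ f : ResidueField R →ₗ[R] R ⧸ (Ideal.ofList rs • ⊤ : Submodule R R), f ≠ 0)
    (Y : Type u) [AddCommGroup Y] [Module R Y] [Module.Finite R Y] (hY : IsWeaklyRegular Y rs)
    (hpd : HasProjectiveDimensionLT (ModuleCat.of R Y) 2) : Module.Projective R Y := by
  obtain ⟨k, π, hπ⟩ := Module.Finite.exists_fin' R Y
  let A := LinearMap.ker π
  have hA : Module.Projective R A := by
    have := (LinearMap.shortExact_shortComplexKer hπ).hasProjectiveDimensionLT_X₁ 1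
      (inferInstanceAs (HasProjectiveDimensionLT (ModuleCat.of R (Fin k → R)) 1)) hpd
    rw [← projective_iff_hasProjectiveDimensionLT_one] at this
    exact (IsProjective.iff_projective A).mpr this
  have hex : Function.Exact A.subtype π := LinearMap.exact_subtype_ker_map π
  suffices hinj : Function.Injective (A.subtype.lTensor (ResidueField R)) by
    have := Module.free_of_lTensor_residueField_injective A.subtype π hπ hex hinj
    infer_instance
  obtain ⟨s, hs⟩ := hsoc
  have hI : (Ideal.ofList rs • ⊤ : Submodule R R) = Ideal.ofList rs := by
    rw [smul_eq_mul, Ideal.mul_top]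
  let s' : ResidueField R →ₗ[R] R ⧸ Ideal.ofList rs :=
    (Submodule.quotEquivOfEq _ _ hI).toLinearMap ∘ₗ s
  have hs' : Function.Injective s' := by
    have : IsSimpleModule R (ResidueField R) :=
      isSimpleModule_iff_quot_maximal.mpr
        ⟨maximalIdeal R, maximalIdeal.isMaximal R, ⟨LinearEquiv.refl R _⟩⟩
    exact (Submodule.quotEquivOfEq _ _ hI).injective.comp (s.injective_of_ne_zero hs)
  have h1 : Function.Injective (s'.rTensor A) := Module.Flat.rTensor_preserves_injective_linearMap _ hs'
  have h2 : Function.Injective (A.subtype.lTensor (R ⧸ Ideal.ofList rs)) := by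
    let q := Submodule.mapQ _ _ A.subtype
      (Submodule.smul_top_le_comap_smul_top (Ideal.ofList rs) A.subtype)
    have hq : Function.Injective q :=
      injective_mapQ_of_isWeaklyRegular A.injective_subtype hex hπ hY
    have hsq : (quotTensorEquivQuotSMul (Fin k → R) (Ideal.ofList rs)).toLinearMap ∘ₗ
        A.subtype.lTensor (R ⧸ Ideal.ofList rs) =
        q ∘ₗ (quotTensorEquivQuotSMul A (Ideal.ofList rs)).toLinearMap := by
      refine TensorProduct.ext' fun x y => ?_
      obtain ⟨x, rfl⟩ := Ideal.Quotient.mk_surjective x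
      simp [q]
    intro x y hxy
    refine (hq.comp (quotTensorEquivQuotSMul A (Ideal.ofList rs)).injective) ?_
    have h' := congrArg (quotTensorEquivQuotSMul (Fin k → R) (Ideal.ofList rs)) hxy
    exact (congr($hsq x)).symm.trans (h'.trans congr($hsq y))
  have hsq : s'.rTensor (Fin k → R) ∘ₗ A.subtype.lTensor (ResidueField R) =
      A.subtype.lTensor (R ⧸ Ideal.ofList rs) ∘ₗ s'.rTensor A :=
    TensorProduct.ext' fun x y => by simp
  intro x y hxy
  have h' := congrArg (s'.rTensor (Fin k → R)) hxy
  exact (h2.comp h1) ((congr($hsq x)).symm.trans (h'.trans congr($hsq y)))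

theorem projective_of_isWeaklyRegular (hreg : IsWeaklyRegular R rs)
    (hsoc : ∃ f : ResidueField R →ₗ[R] R ⧸ (Ideal.ofList rs • ⊤ : Submodule R R), f ≠ 0)
    (n : ℕ) : ∀ (Y : Type u) [AddCommGroup Y] [Module R Y] [Module.Finite R Y],
    IsWeaklyRegular Y rs → HasProjectiveDimensionLT (ModuleCat.of R Y) (n + 1) →
    Module.Projective R Y := by
  induction n with
  | zero =>
    intro Y _ _ _ _ hpd
    rw [zero_add, ← projective_iff_hasProjectiveDimensionLT_one] at hpd
    exact (IsProjective.iff_projective Y).mpr hpd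
  | succ n ih =>
    intro Y _ _ _ hY hpd
    obtain ⟨k, π, hπ⟩ := Module.Finite.exists_fin' R Y
    have hS := LinearMap.shortExact_shortComplexKer hπ
    have hproj := ih (LinearMap.ker π)
      (isWeaklyRegular_of_forall_take (Submodule.injective_subtype _)
        (LinearMap.exact_subtype_ker_map π) hπ (isWeaklyRegular_of_free hreg _)
        fun i _ => hY.take i)
      (hS.hasProjectiveDimensionLT_X₁ (n + 1)
        (hasProjectiveDimensionLT_of_ge (ModuleCat.of R (Fin k → R)) 1 (n + 1) (by lia)) hpd)
    refine projective_of_isWeaklyRegular_of_hasProjectiveDimensionLT_two hsoc Y hY ?_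
    refine hS.hasProjectiveDimensionLT_X₃ 1 ?_
      (hasProjectiveDimensionLT_of_ge (ModuleCat.of R (Fin k → R)) 1 2 (by lia))
    rw [← projective_iff_hasProjectiveDimensionLT_one]
    exact (IsProjective.iff_projective (LinearMap.ker π)).mp hproj

/-- A finitely generated module of finite projective dimension has projective dimension at most
the depth of the ring. -/
theorem hasProjectiveDimensionLT_depth_succ (t : ℕ) (ht : depth R = t) (n : ℕ) (X : Type u)
    [AddCommGroup X] [Module R X] [Module.Finite R X]
    (hpd : HasProjectiveDimensionLT (ModuleCat.of R X) n) :
    HasProjectiveDimensionLT (ModuleCat.of R X) (t + 1) := by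
  obtain ⟨rs, rfl, hm, hreg⟩ := exists_isRegular_length_eq_depth t ht
  have hsoc := exists_hom_residueField_ne_zero rs ht hm hreg
  -- Here `j` counts the syzygies already taken, each making one more element of `rs` regular; when
  -- `d` reaches 0 all of `rs` is regular and the module is projective.
  suffices H : ∀ d j : ℕ, j + d = rs.length → ∀ (X : Type u) [AddCommGroup X] [Module R X]
      [Module.Finite R X], HasProjectiveDimensionLT (ModuleCat.of R X) (n + 1) →
      IsWeaklyRegular X (rs.take j) → HasProjectiveDimensionLT (ModuleCat.of R X) (d + 1) from
    H rs.length 0 (zero_add _) X (hasProjectiveDimensionLT_of_ge _ n (n + 1) n.le_succ) (by rw [List.take_zero]; exact .nil R X)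
  intro d
  induction d with
  | zero =>
    rintro j hj X _ _ _ hpd hX
    rw [add_zero] at hj
    rw [List.take_of_length_le hj.ge] at hX
    rw [zero_add, ← projective_iff_hasProjectiveDimensionLT_one]
    exact (IsProjective.iff_projective X).mp (projective_of_isWeaklyRegular hreg.1 hsoc n X hX
      hpd)
  | succ d ih =>
    intro j hj X _ _ _ hpd hX
    obtain ⟨k, π, hπ⟩ := Module.Finite.exists_fin' R X
    have hS := LinearMap.shortExact_shortComplexKer hπ
    refine hS.hasProjectiveDimensionLT_X₃ (d + 1) (ih (j + 1) (by lia) (LinearMap.ker π) ?_ ?_)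
      (hasProjectiveDimensionLT_of_ge (ModuleCat.of R (Fin k → R)) 1 (d + 2) (by lia))
    · exact hS.hasProjectiveDimensionLT_X₁ (n + 1)
        (hasProjectiveDimensionLT_of_ge (ModuleCat.of R (Fin k → R)) 1 (n + 1) (by lia))
        (hasProjectiveDimensionLT_of_ge _ (n + 1) (n + 2) (by lia))
    · refine isWeaklyRegular_of_forall_take (Submodule.injective_subtype _)
        (LinearMap.exact_subtype_ker_map π) hπ ((isWeaklyRegular_of_free hreg.1 _).take _)
        fun i hi => ?_
      rw [List.take_take, min_eq_left (by simp at hi; lia)]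
      have hij : i ≤ j := by simp at hi; lia
      simpa [List.take_take, min_eq_left hij] using hX.take i

end AuslanderBuchsbaum

end QuasiProj

/-! ### Stable finiteness and Schanuel's lemma. -/

namespace QuasiProj
open Abelian IsLocalRing

variable {R : Type u} [CommRing R]

/-- A module is stably finite if it becomes the direct sum of a finitely generated module and a
projective module after adding a projective module. -/
def IsStablyFinite (R : Type u) [CommRing R] (C : Type u) [AddCommGroup C] [Module R C] : Prop :=
  ∃ X Q Q' : ModuleCat.{u} R, Module.Finite R X ∧ Module.Projective R Q ∧ Module.Projective R Q' ∧
    Nonempty ((C × Q) ≃ₗ[R] (X × Q'))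

section

variable {A B C Z : Type u} [AddCommGroup A] [Module R A] [AddCommGroup B] [Module R B]
  [AddCommGroup C] [Module R C] [AddCommGroup Z] [Module R Z]

/-- Schanuel's lemma. -/
theorem nonempty_ker_prod_equiv [Module.Projective R A] [Module.Projective R B]
    (a : A →ₗ[R] Z) (b : B →ₗ[R] Z) (ha : Function.Surjective a) (hb : Function.Surjective b) :
    Nonempty ((LinearMap.ker a × B) ≃ₗ[R] (LinearMap.ker b × A)) := by
  obtain ⟨s, hs⟩ := Module.projective_lifting_property b a hb
  obtain ⟨r, hr⟩ := Module.projective_lifting_property a b ha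
  replace hs (x : A) : b (s x) = a x := congr($hs x)
  replace hr (x : B) : a (r x) = b x := congr($hr x)
  let ξ : LinearMap.ker a × B →ₗ[R] A :=
    (LinearMap.ker a).subtype.coprod r
  let η : LinearMap.ker b × A →ₗ[R] B :=
    (LinearMap.ker b).subtype.coprod s
  have hξ (x) : a (ξ x) = b x.2 := by simp [ξ, hr]
  have hη (x) : b (η x) = a x.2 := by simp [η, hs]
  let f : LinearMap.ker a × B →ₗ[R] LinearMap.ker b × A :=
    ((LinearMap.snd R _ B - s ∘ₗ ξ).codRestrict _ fun x => by simp [hs, hξ]).prod ξ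
  let g : LinearMap.ker b × A →ₗ[R] LinearMap.ker a × B :=
    ((LinearMap.snd R _ A - r ∘ₗ η).codRestrict _ fun x => by simp [hr, hη]).prod η
  have hf (x) : η (f x) = x.2 := sub_add_cancel _ _
  have hg (x) : ξ (g x) = x.2 := sub_add_cancel _ _
  refine ⟨LinearEquiv.ofLinearMap f g (LinearMap.ext fun x => ?_) (LinearMap.ext fun x => ?_)⟩
  · refine Prod.ext (Subtype.ext ?_) (hg x)
    change η x - s (ξ (g x)) = x.1
    rw [hg]
    exact add_sub_cancel_right _ _
  · refine Prod.ext (Subtype.ext ?_) (hf x)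
    change ξ x - r (η (f x)) = x.1
    rw [hf]
    exact add_sub_cancel_right _ _

/-- Schanuel compares the given cover with one whose kernel is that of a finite free cover of the
finitely generated part. -/
theorem IsStablyFinite.ker [IsNoetherianRing R] [Module.Projective R A] (hC : IsStablyFinite R C)
    (p : A →ₗ[R] C) (hp : Function.Surjective p) : IsStablyFinite R (LinearMap.ker p) := by
  obtain ⟨X, Q, Q', hX, hQ, hQ', ⟨e⟩⟩ := hC
  obtain ⟨k, ρ, hρ⟩ := Module.Finite.exists_fin' R X
  let a : (A × Q) →ₗ[R] (X × Q') := e.toLinearMap ∘ₗ p.prodMap LinearMap.id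
  let b : ((Fin k → R) × Q') →ₗ[R] (X × Q') := ρ.prodMap LinearMap.id
  have ha : Function.Surjective a :=
    e.surjective.comp (Function.Surjective.prodMap hp Function.surjective_id)
  have hb : Function.Surjective b := Function.Surjective.prodMap hρ Function.surjective_id
  have ha0 (x : A) (hx : p x = 0) : a (x, 0) = 0 := by
    change e (p x, 0) = 0
    rw [hx]
    exact e.map_zero
  obtain ⟨E⟩ := nonempty_ker_prod_equiv a b ha hb
  have hfin : Module.Finite R (LinearMap.ker b) := by
    let ι : LinearMap.ker ρ →ₗ[R] LinearMap.ker b :=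
      (LinearMap.inl R _ Q' ∘ₗ (LinearMap.ker ρ).subtype).codRestrict _ fun x => by simp [b]
    refine Module.Finite.of_surjective ι ?_
    rintro ⟨⟨x, q⟩, hx⟩
    obtain ⟨hx', rfl⟩ : ρ x = 0 ∧ q = 0 := by simpa [b] using hx
    exact ⟨⟨x, hx'⟩, rfl⟩
  let ι : LinearMap.ker p →ₗ[R] LinearMap.ker a :=
    (LinearMap.inl R _ Q ∘ₗ (LinearMap.ker p).subtype).codRestrict _ fun x => ha0 x x.2
  have hι : Function.Bijective ι := by
    constructor
    · intro x y hxy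
      exact Subtype.ext (congrArg (fun z => z.1.1) hxy)
    · rintro ⟨⟨x, q⟩, hx⟩
      obtain ⟨hx', rfl⟩ : p x = 0 ∧ q = 0 := by simpa [a] using hx
      exact ⟨⟨x, hx'⟩, rfl⟩
  exact ⟨ModuleCat.of R (LinearMap.ker b), ModuleCat.of R ((Fin k → R) × Q'), ModuleCat.of R (A × Q),
    hfin, inferInstanceAs (Module.Projective R ((Fin k → R) × Q')),
    inferInstanceAs (Module.Projective R (A × Q)),
    ⟨((LinearEquiv.ofBijective ι hι).prodCongr (LinearEquiv.refl R _)).trans E⟩⟩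

theorem IsStablyFinite.of_surjective [IsNoetherianRing R] (hB : IsStablyFinite R B) (p : C →ₗ[R] B)
    (hp : Function.Surjective p) [Module.Finite R (LinearMap.ker p)] : IsStablyFinite R C := by
  obtain ⟨X, Q, Q', hX, hQ, hQ', ⟨e⟩⟩ := hB
  let a : (C × Q) →ₗ[R] (X × Q') := e.toLinearMap ∘ₗ p.prodMap LinearMap.id
  have ha : Function.Surjective a :=
    e.surjective.comp (Function.Surjective.prodMap hp Function.surjective_id)
  have ha0 (x : C) (hx : p x = 0) : a (x, 0) = 0 := by
    change e (p x, 0) = 0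
    rw [hx]
    exact e.map_zero
  -- Since `Q'` is projective, `τ` splits. Its kernel is the new finitely generated part: an
  -- extension of a submodule of `X` by an image of the kernel of `p`.
  let τ : (C × Q) →ₗ[R] Q' := LinearMap.snd R X Q' ∘ₗ a
  have hτ : Function.Surjective τ := Prod.snd_surjective.comp ha
  obtain ⟨σ, hσ⟩ := Module.projective_lifting_property τ LinearMap.id hτ
  have E := ((LinearMap.exact_subtype_ker_map τ).splitSurjectiveEquiv
    (Submodule.injective_subtype _) ⟨σ, hσ⟩).1
  have hfin : Module.Finite R (LinearMap.ker τ) := by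
    let w : LinearMap.ker τ →ₗ[R] X := LinearMap.fst R X Q' ∘ₗ a ∘ₗ (LinearMap.ker τ).subtype
    let v : LinearMap.ker p →ₗ[R] LinearMap.ker w :=
      ((LinearMap.inl R C Q ∘ₗ (LinearMap.ker p).subtype).codRestrict (LinearMap.ker τ)
        fun x => congrArg Prod.snd (ha0 x x.2)).codRestrict _ fun x => congrArg Prod.fst (ha0 x x.2)
    have hv : Function.Surjective v := by
      rintro ⟨⟨⟨c, q⟩, h1⟩, h2⟩
      have h0 : a (c, q) = 0 := Prod.ext h2 h1
      obtain ⟨hc, rfl⟩ : p c = 0 ∧ q = 0 := by simpa [a] using h0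
      exact ⟨⟨c, hc⟩, rfl⟩
    have := Module.Finite.of_surjective v hv
    have := Module.Finite.equiv w.quotKerEquivRange.symm
    exact .of_submodule_quotient (LinearMap.ker w)
  exact ⟨ModuleCat.of R (LinearMap.ker τ), Q, Q', hfin, hQ, hQ', ⟨E⟩⟩

end

theorem hasProjectiveDimensionLT_of_prod_equiv {C X Q Q' : Type u} [AddCommGroup C] [Module R C]
    [AddCommGroup X] [Module R X] [AddCommGroup Q] [Module R Q] [Module.Projective R Q]
    [AddCommGroup Q'] [Module R Q'] (e : (C × Q) ≃ₗ[R] (X × Q')) (n : ℕ)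
    (h : HasProjectiveDimensionLT (ModuleCat.of R C) (n + 1)) :
    HasProjectiveDimensionLT (ModuleCat.of R X) (n + 1) := by
  have hS := ModuleCat.shortComplex_shortExact
    (ModuleCat.shortComplexOfCompEqZero (LinearMap.inl R C Q) (LinearMap.snd R C Q) (by ext; rfl))
    Function.Exact.inl_snd LinearMap.inl_injective LinearMap.snd_surjective
  have : HasProjectiveDimensionLT (ModuleCat.of R (C × Q)) (n + 1) :=
    hS.hasProjectiveDimensionLT_X₂ (n + 1) h
      (hasProjectiveDimensionLT_of_ge (ModuleCat.of R Q) 1 (n + 1) (by lia))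
  let r : Retract (ModuleCat.of R X) (ModuleCat.of R (C × Q)) :=
    { i := ModuleCat.ofHom (e.symm.toLinearMap ∘ₗ LinearMap.inl R X Q')
      r := ModuleCat.ofHom (LinearMap.fst R X Q' ∘ₗ e.toLinearMap)
      retract := by ext; simp }
  exact r.hasProjectiveDimensionLT (n + 1)

/-! ### Modules of chains modulo boundaries. -/

section Complex

variable (P : ChainComplex (ModuleCat.{u} R) ℤ)

theorem pOpcycles_surjective (i : ℤ) : Function.Surjective (P.pOpcycles i).hom :=
  (ModuleCat.epi_iff_surjective _).mp inferInstance

theorem homologyι_injective (i : ℤ) : Function.Injective (P.homologyι i).hom :=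
  (ModuleCat.mono_iff_injective _).mp inferInstance

theorem exact_fromOpcycles_pOpcycles (i : ℤ) :
    Function.Exact (P.fromOpcycles (i + 1) i).hom (P.pOpcycles i).hom := by
  have h : (ShortComplex.mk _ _ (P.d_pOpcycles (i + 1) i)).Exact :=
    ShortComplex.exact_of_g_is_cokernel _ (P.opcyclesIsCokernel (i + 1) i (by simp))
  rw [ShortComplex.ShortExact.moduleCat_exact_iff_function_exact] at h
  intro x
  rw [h x]
  constructor
  · rintro ⟨y, rfl⟩
    exact ⟨(P.pOpcycles (i + 1)).hom y, congr(($(P.p_fromOpcycles (i + 1) i)).hom y)⟩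
  · rintro ⟨y, rfl⟩
    obtain ⟨z, rfl⟩ := pOpcycles_surjective P (i + 1) y
    exact ⟨z, congr(($(P.p_fromOpcycles (i + 1) i)).hom z).symm⟩

theorem exact_homologyι_fromOpcycles (i : ℤ) :
    Function.Exact (P.homologyι (i + 1)).hom (P.fromOpcycles (i + 1) i).hom := by
  have h : (ShortComplex.mk _ _ (P.homologyι_comp_fromOpcycles (i + 1) i)).Exact :=
    ShortComplex.exact_of_f_is_kernel _ (P.homologyIsKernel (i + 1) i (by simp))
  exact (ShortComplex.ShortExact.moduleCat_exact_iff_function_exact _).mp h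

end Complex

end QuasiProj

namespace QuasiProj
open Abelian IsLocalRing

variable {R : Type u} [CommRing R]

section Complex

variable {P : ChainComplex (ModuleCat.{u} R) ℤ}

theorem subsingleton_opcycles (i : ℤ) (h : Subsingleton (P.X i)) : Subsingleton (P.opcycles i) :=
  (pOpcycles_surjective P i).subsingleton

theorem shortExact_ker_pOpcycles (i : ℤ) :
    (P.pOpcycles i).hom.shortComplexKer.ShortExact :=
  LinearMap.shortExact_shortComplexKer (pOpcycles_surjective P i)

/-- The surjection from `P_{i+1}` modulo boundaries onto the boundaries in `P_i`. -/
noncomputable def toBoundaries (P : ChainComplex (ModuleCat.{u} R) ℤ) (i : ℤ) :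
    P.opcycles (i + 1) →ₗ[R] LinearMap.ker (P.pOpcycles i).hom :=
  (P.fromOpcycles (i + 1) i).hom.codRestrict _ fun x =>
    (exact_fromOpcycles_pOpcycles P i).apply_apply_eq_zero x

theorem toBoundaries_surjective (i : ℤ) : Function.Surjective (toBoundaries P i) := by
  rintro ⟨x, hx⟩
  obtain ⟨y, rfl⟩ := (exact_fromOpcycles_pOpcycles P i x).mp hx
  exact ⟨y, rfl⟩

theorem exact_homologyι_toBoundaries (i : ℤ) :
    Function.Exact (P.homologyι (i + 1)).hom (toBoundaries P i) := by
  intro x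
  rw [← exact_homologyι_fromOpcycles P i x]
  exact Subtype.ext_iff

theorem shortExact_homology_opcycles_boundaries (i : ℤ) :
    (ModuleCat.shortComplexOfCompEqZero (P.homologyι (i + 1)).hom (toBoundaries P i)
      (exact_homologyι_toBoundaries i).linearMap_comp_eq_zero).ShortExact :=
  ModuleCat.shortComplex_shortExact _ (exact_homologyι_toBoundaries i)
    (homologyι_injective P (i + 1)) (toBoundaries_surjective i)

theorem isStablyFinite_opcycles [IsNoetherianRing R] (hproj : ∀ i, Module.Projective R (P.X i))
    (hfin : ∀ i, Module.Finite R (P.homology i)) {b : ℤ} (hb : ∀ i < b, Subsingleton (P.X i))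
    (j : ℤ) : IsStablyFinite R (P.opcycles j) := by
  suffices H : ∀ n : ℕ, ∀ j : ℤ, j < b + n → IsStablyFinite R (P.opcycles j) from
    H (j - b + 1).toNat j (by lia)
  intro n
  induction n with
  | zero =>
    intro j hj
    have := subsingleton_opcycles j (hb j (by simpa using hj))
    exact ⟨ModuleCat.of R PUnit.{u + 1}, ModuleCat.of R PUnit.{u + 1}, ModuleCat.of R PUnit.{u + 1},
      inferInstanceAs (Module.Finite R PUnit.{u + 1}), inferInstanceAs (Module.Projective R PUnit.{u + 1}),
      inferInstanceAs (Module.Projective R PUnit.{u + 1}),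
      ⟨(0 : (P.opcycles j × PUnit.{u + 1}) ≃ₗ[R] (PUnit.{u + 1} × PUnit.{u + 1}))⟩⟩
  | succ n ih =>
    intro j hj
    obtain ⟨i, rfl⟩ : ∃ i, j = i + 1 := ⟨j - 1, by lia⟩
    have := hproj i
    have hker : Module.Finite R (LinearMap.ker (toBoundaries P i)) := by
      have := hfin (i + 1)
      rw [(exact_homologyι_toBoundaries i).linearMap_ker_eq]
      exact Module.Finite.range _
    exact ((ih i (by push_cast at hj; lia)).ker _ (pOpcycles_surjective P i)).of_surjective _
      (toBoundaries_surjective i)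

/-- From degree `h` upwards there is no higher homology, so P_{j+1} modulo boundaries is isomorphic
to the boundaries in P_j, and the part of `P` in degrees ≥ j resolves P_j modulo boundaries. -/
theorem hasProjectiveDimensionLT_opcycles (hproj : ∀ i, Module.Projective R (P.X i)) {s h : ℤ}
    (hs : ∀ i > s, Subsingleton (P.X i)) (hh : ∀ i > h, Subsingleton (P.homology i)) (n : ℕ) :
    ∀ j : ℤ, h ≤ j → s < j + n → HasProjectiveDimensionLT (P.opcycles j) n := by
  induction n with
  | zero =>
    intro j _ hj
    have := subsingleton_opcycles j (hs j (by simpa using hj))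
    exact (ModuleCat.isZero_of_subsingleton _).hasProjectiveDimensionLT_zero
  | succ n ih =>
    intro j hj hsj
    have := ih (j + 1) (by lia) (by push_cast at hsj; lia)
    have := hh (j + 1) (by lia)
    have hinj : Function.Injective (toBoundaries P j) := by
      rw [← LinearMap.ker_eq_bot, (exact_homologyι_toBoundaries j).linearMap_ker_eq]
      exact LinearMap.range_eq_bot.mpr (LinearMap.ext fun x => by
        rw [Subsingleton.elim x 0, map_zero, map_zero])
    have e := LinearEquiv.ofBijective _ ⟨hinj, toBoundaries_surjective j⟩
    have hP : Projective (P.X j) := by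
      rw [← IsProjective.iff_projective]; exact hproj j
    exact (shortExact_ker_pOpcycles j).hasProjectiveDimensionLT_X₃ n
      (hasProjectiveDimensionLT_of_iso e.toModuleIso n)
      (hasProjectiveDimensionLT_of_ge (P.X j) 1 (n + 1) (by lia))

theorem subsingleton_ext_ker_pOpcycles (hproj : ∀ i, Module.Projective R (P.X i))
    (N : ModuleCat.{u} R) (j : ℤ) (i : ℕ) (h : Subsingleton (Ext (P.opcycles j) N (i + 2))) :
    Subsingleton (Ext (ModuleCat.of R (LinearMap.ker (P.pOpcycles j).hom)) N (i + 1)) := by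
  have hP : Projective (P.X j) := by
    rw [← IsProjective.iff_projective]; exact hproj j
  exact subsingleton_ext_contra_X₁ (shortExact_ker_pOpcycles j) N (i + 1)
    (Ext.subsingleton_of_projective (P.X j) N i) h

/-- Induction upwards from the lower bound of `P`: vanishing of Ext^{i+1} for P_j modulo boundaries
gives vanishing of Ext^i for the boundaries in P_j, and the homology in degree j + 1 supplies the
other end. -/
theorem subsingleton_ext_opcycles (hproj : ∀ i, Module.Projective R (P.X i)) {b : ℤ}
    (hb : ∀ i < b, Subsingleton (P.X i)) (N : ModuleCat.{u} R) (r : ℕ)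
    (hN : ∀ i j, r < i → Subsingleton (Ext (P.homology j) N i)) (j : ℤ) (i : ℕ) (hi : r < i) :
    Subsingleton (Ext (P.opcycles j) N i) := by
  suffices H : ∀ n : ℕ, ∀ j : ℤ, j < b + n → ∀ i, r < i → Subsingleton (Ext (P.opcycles j) N i) from
    H (j - b + 1).toNat j (by lia) i hi
  intro n
  induction n with
  | zero =>
    intro j hj i _
    have := subsingleton_opcycles j (hb j (by simpa using hj))
    have := (ModuleCat.isZero_of_subsingleton (P.opcycles j)).hasProjectiveDimensionLT_zero
    exact HasProjectiveDimensionLT.subsingleton (P.opcycles j) 0 i (Nat.zero_le i) N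
  | succ n ih =>
    intro j hj i hi
    obtain ⟨j, rfl⟩ : ∃ j', j = j' + 1 := ⟨j - 1, by lia⟩
    obtain ⟨i, rfl⟩ : ∃ i', i = i' + 1 := ⟨i - 1, by lia⟩
    exact subsingleton_ext_contra_X₂ (shortExact_homology_opcycles_boundaries j) N (i + 1)
      (hN (i + 1) (j + 1) hi)
      (subsingleton_ext_ker_pOpcycles hproj N j i
        (ih j (by push_cast at hj; lia) (i + 2) (by lia)))

/-- If `Ext^i(H_j(P), N) = 0` for all `i > r` and all `j`, and `Ext^r(P_h/B_h, N) = 0`, then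
`Ext^r(H_h(P), N) = 0`. -/
theorem subsingleton_ext_homology (hproj : ∀ i, Module.Projective R (P.X i)) {b : ℤ}
    (hb : ∀ i < b, Subsingleton (P.X i)) (N : ModuleCat.{u} R) (r : ℕ)
    (hN : ∀ i j, r < i → Subsingleton (Ext (P.homology j) N i)) (h : ℤ)
    (hr : Subsingleton (Ext (P.opcycles h) N r)) : Subsingleton (Ext (P.homology h) N r) := by
  obtain ⟨h, rfl⟩ : ∃ j', h = j' + 1 := ⟨h - 1, by lia⟩
  exact subsingleton_ext_contra_X₁ (shortExact_homology_opcycles_boundaries h) N r hr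
    (subsingleton_ext_ker_pOpcycles hproj N h r
      (subsingleton_ext_opcycles hproj hb N r hN h (r + 2) (by lia)))

end Complex

/-! ### Ext of finite powers, and of modules of finite projective dimension. -/

section FinitePower

theorem sum_single_comp_proj (a : ℕ) (M : Type u) [AddCommGroup M] [Module R M] :
    ∑ i : Fin a, ModuleCat.ofHom (LinearMap.proj (R := R) (φ := fun _ : Fin a => M) i) ≫
      ModuleCat.ofHom (LinearMap.single R (fun _ : Fin a => M) i) =
      𝟙 (ModuleCat.of R (Fin a → M)) := by
  ext x j
  simp [Finset.sum_apply, Pi.single_apply]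

theorem subsingleton_ext_pi_left (a : ℕ) (M : Type u) [AddCommGroup M] [Module R M]
    (N : ModuleCat.{u} R) (n : ℕ) (h : Subsingleton (Ext (ModuleCat.of R M) N n)) :
    Subsingleton (Ext (ModuleCat.of R (Fin a → M)) N n) := by
  refine subsingleton_of_forall_eq 0 fun x => ?_
  rw [← Ext.mk₀_id_comp x, ← sum_single_comp_proj, Ext.mk₀_sum, Ext.sum_comp]
  refine Finset.sum_eq_zero fun i _ => ?_
  rw [← Ext.mk₀_comp_mk₀_assoc, Subsingleton.elim ((Ext.mk₀ _).comp x (zero_add n)) 0,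
    Ext.comp_zero]

theorem subsingleton_ext_pi_right (a : ℕ) (M : Type u) [AddCommGroup M] [Module R M]
    (N : ModuleCat.{u} R) (n : ℕ) (h : Subsingleton (Ext N (ModuleCat.of R M) n)) :
    Subsingleton (Ext N (ModuleCat.of R (Fin a → M)) n) := by
  refine subsingleton_of_forall_eq 0 fun x => ?_
  rw [← Ext.comp_mk₀_id x, ← sum_single_comp_proj, Ext.mk₀_sum, Ext.comp_sum]
  refine Finset.sum_eq_zero fun i _ => ?_
  rw [← Ext.mk₀_comp_mk₀, ← Ext.comp_assoc_of_second_deg_zero,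
    Subsingleton.elim (x.comp (Ext.mk₀ _) (add_zero n)) 0, Ext.zero_comp]

end FinitePower

/-- A finite free cover of `N` embeds Ext^i(C, N) into Ext^{i+1}(C, K), K its kernel, because
Ext^i(C, R) = 0 for i > t. Iteration passes the projective dimension of `C`. -/
theorem subsingleton_ext_of_hasInjectiveDimensionLT [IsNoetherianRing R] (t n : ℕ)
    (hR : HasInjectiveDimensionLT (ModuleCat.of R R) (t + 1)) (C : ModuleCat.{u} R)
    (hC : HasProjectiveDimensionLT C n) (N : ModuleCat.{u} R) (hN : Module.Finite R N) (i : ℕ)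
    (hi : t < i) : Subsingleton (Ext C N i) := by
  suffices H : ∀ d i : ℕ, t < i → n ≤ i + d → ∀ N : ModuleCat.{u} R, Module.Finite R N →
      Subsingleton (Ext C N i) from H n i hi (by lia) N hN
  intro d
  induction d with
  | zero => exact fun i _ hni N _ => HasProjectiveDimensionLT.subsingleton C n i hni N
  | succ d ih =>
    intro i hi hni N _
    obtain ⟨k, π, hπ⟩ := Module.Finite.exists_fin' R N
    exact subsingleton_ext_co_X₃ (LinearMap.shortExact_shortComplexKer hπ) C i
      (subsingleton_ext_pi_right k R C i (HasInjectiveDimensionLT.subsingleton _ (t + 1) i hi C))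
      (ih (i + 1) (by lia) (by lia) (ModuleCat.of R (LinearMap.ker π))
        (inferInstanceAs (Module.Finite R (LinearMap.ker π))))

end QuasiProj

/-! ### Consequences of finite quasi-projective dimension. -/

namespace QuasiProj
open Abelian IsLocalRing

variable {R : Type u} [CommRing R]

/-- The data provided by a finite quasi-projective dimension of a nonzero module `M`. -/
theorem exists_resolution_of_qpd_lt_top {M : Type u} [AddCommGroup M] [Module R M] [Nontrivial M]
    (h : qpd R M < ⊤) : ∃ (P : ChainComplex (ModuleCat.{u} R) ℤ) (b s h : ℤ) (a : ℤ → ℕ),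
      (∀ i < b, Subsingleton (P.X i)) ∧ (∀ i > s, Subsingleton (P.X i)) ∧
      (∀ i, Module.Projective R (P.X i)) ∧
      (∀ i, Nonempty (P.homology i ≅ ModuleCat.of R (Fin (a i) → M))) ∧ a h ≠ 0 ∧
      ∀ i > h, Subsingleton (P.homology i) := by
  rw [qpd, if_neg (not_subsingleton M), ← WithBot.coe_top, WithBot.coe_lt_coe, sInf_lt_iff] at h
  obtain ⟨d, ⟨P, hP, s, h, n, hs, hh, -⟩, -⟩ := h
  obtain ⟨b, hb⟩ := hP.boundedBelow
  obtain ⟨a, -, ha⟩ := hP.homology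
  refine ⟨P, b, s, h, a, hb, fun i hi => not_nontrivial_iff_subsingleton.mp fun hX =>
    not_lt_of_ge (hs.2 hX) hi, hP.projective, ha, fun h0 => ?_, fun i hi =>
    not_nontrivial_iff_subsingleton.mp fun hX => not_lt_of_ge (hh.2 hX) hi⟩
  have hnt : Nontrivial (P.homology h) := hh.1
  obtain ⟨e⟩ := ha h
  rw [h0] at e
  exact not_subsingleton _ (e.toLinearEquiv.toEquiv.subsingleton)

/-- A finitely generated module of finite quasi-projective dimension embeds into the direct sum of
a finitely generated module of projective dimension at most the depth of the ring and a projective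
module. -/
theorem exists_injective_of_qpd_lt_top [IsLocalRing R] [IsNoetherianRing R] (t : ℕ)
    (ht : depth R = t) {M : Type u} [AddCommGroup M] [Module R M] [Nontrivial M] [Module.Finite R M]
    (h : qpd R M < ⊤) : ∃ (X Q : ModuleCat.{u} R) (ι : M →ₗ[R] X × Q), Module.Finite R X ∧
      HasProjectiveDimensionLT X (t + 1) ∧ Module.Projective R Q ∧ Function.Injective ι := by
  obtain ⟨P, b, s, h, a, hb, hs, hproj, hhom, ha, hh⟩ := exists_resolution_of_qpd_lt_top h
  have hfin (i : ℤ) : Module.Finite R (P.homology i) :=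
    Module.Finite.equiv (hhom i).some.symm.toLinearEquiv
  obtain ⟨X, Q, Q', hX, hQ, hQ', ⟨e⟩⟩ := isStablyFinite_opcycles hproj hfin hb h
  have hpd := hasProjectiveDimensionLT_opcycles hproj hs hh ((s - h).toNat + 1) h le_rfl (by
    push_cast; lia)
  have hpdX := hasProjectiveDimensionLT_depth_succ t ht _ X
    (hasProjectiveDimensionLT_of_prod_equiv e _ hpd)
  obtain ⟨E⟩ := hhom h
  let i₀ : Fin (a h) := ⟨0, Nat.pos_of_ne_zero ha⟩
  have hsingle : Function.Injective (LinearMap.single R (fun _ : Fin (a h) => M) i₀) :=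
    fun x y hxy => by simpa using congrFun hxy i₀
  refine ⟨X, Q', e.toLinearMap ∘ₗ LinearMap.inl R _ Q ∘ₗ (P.homologyι h).hom ∘ₗ
    E.symm.toLinearEquiv.toLinearMap ∘ₗ LinearMap.single R (fun _ => M) i₀, hX, hpdX, hQ', ?_⟩
  exact e.injective.comp (LinearMap.inl_injective.comp ((homologyι_injective P h).comp
    (E.symm.toLinearEquiv.injective.comp hsingle)))

/-- In an embedding of `T` into X × Q, the component in `X` factors through a free module and `Q` is
projective. An element killed by all functionals on `T` therefore has both components zero. -/
theorem IsSyzygy.torsionless_transpose [IsLocalRing R] [IsNoetherianRing R] (t : ℕ)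
    (ht : depth R = t) {M Ω P₁ P₀ : ModuleCat.{u} R} (hΩ : IsSyzygy R M t Ω) (f : P₁ →ₗ[R] P₀)
    (g : P₀ →ₗ[R] Ω) [Module.Finite R P₁] [Module.Projective R P₁] [Module.Finite R P₀]
    [Module.Projective R P₀] (hfg : Function.Exact f g) (hg : Function.Surjective g)
    {T : Type u} [AddCommGroup T] [Module R T]
    (e : T ≃ₗ[R] (Module.Dual R P₁ ⧸ LinearMap.range f.dualMap)) (hT : qpd R T < ⊤) (x : T)
    (hx : ∀ θ : Module.Dual R T, θ x = 0) : x = 0 := by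
  obtain hsub | hnt := subsingleton_or_nontrivial T
  · exact Subsingleton.elim x 0
  have : Module.Finite R T := Module.Finite.equiv e.symm
  obtain ⟨X, Q, ι, hX, hpd, hQ, hι⟩ := exists_injective_of_qpd_lt_top t ht hT
  let q := LinearMap.fst R X Q ∘ₗ ι ∘ₗ e.symm.toLinearMap
  obtain ⟨j, α, β, hα, hβ⟩ := hΩ.exists_factorization t f g hfg hg X hpd
    (q ∘ₗ (LinearMap.range f.dualMap).mkQ)
    (by rw [LinearMap.comp_assoc, LinearMap.range_mkQ_comp, LinearMap.comp_zero])
  have hker : LinearMap.range f.dualMap ≤ LinearMap.ker α := LinearMap.range_le_ker_iff.mpr hα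
  let α' : T →ₗ[R] Fin j → R := (LinearMap.range f.dualMap).liftQ α hker ∘ₗ e.toLinearMap
  have hα' (y : T) : (ι y).1 = β (α' y) := by
    obtain ⟨z, hz⟩ := (LinearMap.range f.dualMap).mkQ_surjective (e y)
    have h1 := congr($hβ z)
    have h2 : α' y = α z := by
      change (LinearMap.range f.dualMap).liftQ α hker (e y) = _
      rw [← hz]
      rfl
    rw [h2]
    refine Eq.trans ?_ h1.symm
    change _ = (ι (e.symm ((LinearMap.range f.dualMap).mkQ z))).1
    rw [hz, e.symm_apply_apply]
  refine hι ?_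
  rw [map_zero]
  refine Prod.ext ?_ ?_
  · have : α' x = 0 := funext fun c => hx (LinearMap.proj c ∘ₗ α')
    rw [hα', this, map_zero]
    rfl
  · exact (Module.forall_dual_apply_eq_zero_iff R _).mp fun ψ => hx (ψ ∘ₗ LinearMap.snd R X Q ∘ₗ ι)

theorem hasInjectiveDimensionLT_of_transpose [IsLocalRing R] [IsNoetherianRing R] (t : ℕ)
    (ht : depth R = t) (Ω : ModuleCat.{u} R)
    (hΩ : IsSyzygy R (ModuleCat.of R (ResidueField R)) t Ω) (T : ModuleCat.{u} R)
    (hT : IsTranspose R Ω T) (hq : qpd R T < ⊤) :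
    HasInjectiveDimensionLT (ModuleCat.of R R) (t + 1) := by
  obtain ⟨P₁, P₀, f, g, _, _, _, _, hfg, hg, ⟨e⟩⟩ := hT
  refine hasInjectiveDimensionLT_of_subsingleton_ext_residueField t ht ?_
  refine hΩ.subsingleton_ext (ModuleCat.of R R) t Ω 0 ?_
  exact subsingleton_ext_one_of_forall_dual f g hfg hg (mem_range_dualMap_of_torsionless f e
    (hΩ.torsionless_transpose t ht f g hfg hg e hq))

theorem exists_isSyzygy [IsNoetherianRing R] (M : ModuleCat.{u} R) [Module.Finite R M] (n : ℕ) :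
    ∃ X : ModuleCat.{u} R, Module.Finite R X ∧ IsSyzygy R M n X := by
  induction n with
  | zero => exact ⟨M, inferInstance, ⟨LinearEquiv.refl R M⟩⟩
  | succ n ih =>
    obtain ⟨Y, _, hY⟩ := ih
    obtain ⟨k, π, hπ⟩ := Module.Finite.exists_fin' R Y
    exact ⟨ModuleCat.of R (LinearMap.ker π), inferInstanceAs (Module.Finite R (LinearMap.ker π)),
      Y, hY, ModuleCat.of R (Fin k → R), π, inferInstanceAs (Module.Finite R (Fin k → R)),
      inferInstanceAs (Module.Projective R (Fin k → R)), hπ, ⟨LinearEquiv.refl R _⟩⟩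

theorem exists_isTranspose [IsNoetherianRing R] (M : ModuleCat.{u} R) [Module.Finite R M] :
    ∃ T : ModuleCat.{u} R, Module.Finite R T ∧ IsTranspose R M T := by
  obtain ⟨k, π, hπ⟩ := Module.Finite.exists_fin' R M
  obtain ⟨l, ρ, hρ⟩ := Module.Finite.exists_fin' R (LinearMap.ker π)
  let f : (Fin l → R) →ₗ[R] (Fin k → R) := (LinearMap.ker π).subtype ∘ₗ ρ
  have hf : Function.Exact f π := by
    rw [LinearMap.exact_iff, LinearMap.range_comp, LinearMap.range_eq_top.mpr hρ, Submodule.map_top,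
      Submodule.range_subtype]
  exact ⟨ModuleCat.of R (Module.Dual R (Fin l → R) ⧸ LinearMap.range f.dualMap),
    inferInstanceAs (Module.Finite R (Module.Dual R (Fin l → R) ⧸ LinearMap.range f.dualMap)),
    ModuleCat.of R (Fin l → R), ModuleCat.of R (Fin k → R), f, π,
    inferInstanceAs (Module.Finite R (Fin l → R)), inferInstanceAs (Module.Projective R (Fin l → R)),
    inferInstanceAs (Module.Finite R (Fin k → R)), inferInstanceAs (Module.Projective R (Fin k → R)),
    hf, hπ, ⟨LinearEquiv.refl R _⟩⟩

theorem depth_le_ringKrullDim [IsLocalRing R] [IsNoetherianRing R] :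
    (depth R : WithBot ℕ∞) ≤ ringKrullDim R := by
  have hne : ringKrullDim R ≠ ⊥ := ringKrullDim_ne_bot
  obtain ⟨d, hd⟩ := WithBot.ne_bot_iff_exists.mp hne
  rw [← hd, WithBot.coe_le_coe]
  refine sSup_le ?_
  rintro _ ⟨rs, hm, hreg, rfl⟩
  have h := ringKrullDim_add_length_eq_ringKrullDim_of_isRegular rs hreg
  have hnt : Nontrivial (R ⧸ Ideal.ofList rs) := Ideal.Quotient.nontrivial_iff.mpr
    (ne_top_of_le_ne_top (maximalIdeal.isMaximal R).ne_top (Ideal.span_le.mpr hm))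
  rw [← WithBot.coe_le_coe, hd, ← h]
  exact le_add_of_nonneg_left ringKrullDim_nonneg_of_nontrivial

theorem subsingleton_ext_of_qpd_lt_top [IsNoetherianRing R] (t : ℕ)
    (hR : HasInjectiveDimensionLT (ModuleCat.of R R) (t + 1)) (M N : ModuleCat.{u} R)
    (hM : qpd R M < ⊤) (hN : Module.Finite R N) (n : ℕ)
    (hn : ∀ i, n ≤ i → Subsingleton (Ext M N i)) (i : ℕ) (hi : t < i) :
    Subsingleton (Ext M N i) := by
  obtain hsub | hnt := subsingleton_or_nontrivial M
  · have := (ModuleCat.isZero_of_subsingleton M).hasProjectiveDimensionLT_zero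
    exact HasProjectiveDimensionLT.subsingleton M 0 i (Nat.zero_le i) N
  obtain ⟨P, b, s, h, a, hb, hs, hproj, hhom, ha, hh⟩ := exists_resolution_of_qpd_lt_top hM
  have hpd := hasProjectiveDimensionLT_opcycles hproj hs hh ((s - h).toNat + 1) h le_rfl (by
    push_cast; lia)
  -- Descending induction on `r`, measured by `d` ≥ n - r: all Ext^i with i > r are already zero.
  suffices H : ∀ d r : ℕ, t < r → n ≤ r + d → Subsingleton (Ext M N r) from H n i hi (by lia)
  intro d
  induction d using Nat.strong_induction_on with
  | _ d ih =>
  intro r hr hd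
  obtain hnr | hrn := le_or_gt n r
  · exact hn r hnr
  have hN' (i : ℕ) (j : ℤ) (hi : r < i) : Subsingleton (Ext (P.homology j) N i) := by
    obtain ⟨E⟩ := hhom j
    refine subsingleton_ext_of_retract E.retract N i (subsingleton_ext_pi_left (a j) M N i ?_)
    exact ih (d - 1) (by lia) i (by lia) (by lia)
  have hH := subsingleton_ext_homology hproj hb N r hN' h
    (subsingleton_ext_of_hasInjectiveDimensionLT t _ hR _ hpd N hN r hr)
  obtain ⟨E⟩ := hhom h
  let i₀ : Fin (a h) := ⟨0, Nat.pos_of_ne_zero ha⟩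
  let ret : Retract M (ModuleCat.of R (Fin (a h) → M)) :=
    { i := ModuleCat.ofHom (LinearMap.single R (fun _ => M) i₀)
      r := ModuleCat.ofHom (LinearMap.proj i₀)
      retract := by ext; simp }
  exact subsingleton_ext_of_retract (ret.trans E.symm.retract) N r hH

end QuasiProj

theorem theorem6p6 (R : Type u) [CommRing R] [IsLocalRing R] [IsNoetherianRing R] :
    (∀ t : ℕ, QuasiProj.depth R = t →
      ∀ Ω : ModuleCat.{u} R,
        QuasiProj.IsSyzygy R (ModuleCat.of R (IsLocalRing.ResidueField R)) t Ω →
      ∀ T : ModuleCat.{u} R, QuasiProj.IsTranspose R Ω T →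
        QuasiProj.qpd R T < ⊤ → QuasiProj.IsGorensteinLocalRing R) ∧
    ((∀ M : ModuleCat.{u} R, Module.Finite R M → QuasiProj.qpd R M < ⊤) →
      QuasiProj.IsABRing R) := by
  have hgor (t : ℕ) (h : HasInjectiveDimensionLT (ModuleCat.of R R) (t + 1)) :
      QuasiProj.IsGorensteinLocalRing R :=
    ⟨inferInstance, inferInstance,
      ((injectiveDimension_lt_iff (n := t + 1)).mpr h).trans_le le_top⟩
  refine ⟨fun t ht Ω hΩ T hT hq =>
    hgor t (QuasiProj.hasInjectiveDimensionLT_of_transpose t ht Ω hΩ T hT hq), fun hall => ?_⟩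
  -- This makes the depth a natural number `t`, and later turns i > dim R into i > t.
  have hdepth := QuasiProj.depth_le_ringKrullDim (R := R)
  have hlt : QuasiProj.depth R < ⊤ :=
    WithBot.coe_lt_coe.mp (hdepth.trans_lt ringKrullDim_lt_top)
  obtain ⟨t, ht⟩ := ENat.ne_top_iff_exists.mp hlt.ne
  have hk : Module.Finite R (IsLocalRing.ResidueField R) :=
    inferInstanceAs (Module.Finite R (R ⧸ IsLocalRing.maximalIdeal R))
  obtain ⟨Ω, _, hΩ⟩ :=
    QuasiProj.exists_isSyzygy (ModuleCat.of R (IsLocalRing.ResidueField R)) t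
  obtain ⟨T, hTfin, hT⟩ := QuasiProj.exists_isTranspose Ω
  have hR := QuasiProj.hasInjectiveDimensionLT_of_transpose t ht.symm Ω hΩ T hT (hall T hTfin)
  refine ⟨hgor t hR, fun M N hM hN ⟨n, hn⟩ i hi => ?_⟩
  refine QuasiProj.subsingleton_ext_of_qpd_lt_top t hR M N (hall M hM) hN n hn i ?_
  have := hdepth.trans_lt hi
  rw [← ht] at this
  exact_mod_cast this
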